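/- **Conventions.** Predicates (each of an arity $\ge 1$, with infinitely many of every arity), constants and variables form countably infinite, pairwise disjoint sets. A *rule* is a function- and constant-free formula $\rho=\forall\vec w,\vec x.\,[\beta(\vec w,\vec x)\to\bigvee_{i=1}^n\exists\vec y_i.\,\eta_i(\vec x_i,\vec y_i)]$ with $n\ge1$, pairwise disjoint lists $\vec w,\vec x,\vec y_1,\dots,\vec y_n$ of variables, $\bigcup_i\vec x_i=\vec x$, and $\beta,\eta_1,\dots,\eta_n$ non-empty conjunctions of atoms (treated as sets) whose variables are exactly the displayed ones; put $\mathrm{branching}(\rho)=n$. It is *datalog* if $n=1$ and $\vec y_1$ is empty. For all $\rho$, $i$ and $y\in\vec y_i$ let $f^\rho_{i,y}$ be a function symbol unique for $(\rho,i,y)$, applied to the list $\vec x$ (it is nullary if $\vec x$ is empty). A *fact* is a variable-free atom. A *knowledge base* (KB) $(\mathcal R,D)$ consists of a set $\mathcal R$ of rules and a set $D$ of function-free facts. A *trigger* is a pair $\lambda=(\rho,\sigma)$ of a rule $\rho$ and a map $\sigma$ from the variables of $\beta$ to variable-free terms. It is an *$\mathcal R$-trigger* if $\rho\in\mathcal R$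 and all terms $\sigma(x)$ are built from constants and the symbols $f^{\rho'}_{i,y}$ with $\rho'\in\mathcal R$. It is *loaded* for a fact set $F$ if $\beta\sigma\subseteq F$, and *obsolete* for $F$ if $\eta_i\tau\subseteq F$ for some $i$ and some extension $\tau$ of $\sigma$. Its $i$-th *output* $\mathrm{out}_i(\lambda)$ is obtained from $\eta_i$ by replacing every $y\in\vec y_i$ by $f^\rho_{i,y}(\vec x)$ and then applying $\sigma$. A fact set $F$ *satisfies* $\rho$ if every trigger with $\rho$ that is loaded for $F$ is obsolete for $F$. A *chase tree* of $(\mathcal R,D)$ is a (finite or infinite) directed rooted tree whose vertices $v$ are labelled with fact sets $F(v)$, and whose non-root vertices are also labelled with triggers, such that: 1. the root is labelled with $D$; 2. for every non-leaf $v$ there is an $\mathcal R$-trigger $\lambda=(\rho,\sigma)$, loaded and not obsolete for $F(v)$, such that $F(v)$ satisfies all datalog rules of $\mathcal R$ if $\rho$ is not datalog, and $v$ has exactly $n=\mathrm{branching}(\rho)$ children $c_1,\dots,c_n$, with $F(c_i)=F(v)\cup\mathrm{out}_i(\lambda)$ and trigger-label $\lambda$; 3. $F(v)$ satisfies all rules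 of $\mathcal R$ for every leaf $v$; and for every $\mathcal R$-trigger $\lambda$ that is loaded for some $F(v)$ there is $k\ge0$ such that $\lambda$ is obsolete for $F(u)$ for every $u$ reachable from $v$ by a path of length $k$. A *head-choice* for $\mathcal R$ is a map $\mathrm{hc}$ with $\mathrm{hc}(\rho)\in\{1,\dots,\mathrm{branching}(\rho)\}$ for every $\rho\in\mathcal R$; write $\mathrm{out}_{\mathrm{hc}}(\lambda)=\mathrm{out}_{\mathrm{hc}(\rho)}(\lambda)$. The *$\mathrm{hc}$-branch* of a chase tree is the maximal path $v_1,v_2,\dots$ from the root such that $F(v_{j+1})=F(v_j)\cup\mathrm{out}_{\mathrm{hc}}(\lambda_{j+1})$ for all $j$, with $\lambda_{j+1}$ the trigger-label of $v_{j+1}$. An $\mathcal R$-trigger $\lambda$ is *g-unblockable* for $(\mathcal R,D)$ and $\mathrm{hc}$ if, for every chase tree of $(\mathcal R,D)$ and every vertex $v$ of its $\mathrm{hc}$-branch such that $\lambda$ is loaded for $F(v)$, there is a vertex $u$ of this branch with $\mathrm{out}_{\mathrm{hc}}(\lambda)\subseteq F(u)$. **Theorem.** The following problem is undecidable: given a KB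 $(\mathcal R,D)$ with finite $\mathcal R$ and $D$, a head-choice $\mathrm{hc}$ for $\mathcal R$, and an $\mathcal R$-trigger $\lambda$, decide whether $\lambda$ is g-unblockable for $(\mathcal R,D)$ and $\mathrm{hc}$. That is, no algorithm answers this question correctly on all such inputs. -/

import Mathlib

namespace DisjChase

/-- Variables and constants are countably infinite sets; they are kept apart by typing, since rules
only contain variables and facts only contain ground terms. -/
abbrev Var := ℕ

/-- Predicates: the pair `(p, k)` is the `p`-th predicate of arity `k + 1`. -/
abbrev Pred := ℕ × ℕ

/-- The arity of a predicate; it is at least one. -/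
def Pred.arity (P : Pred) : ℕ := P.2 + 1

/-- Expressions `P(t₁, …, tₙ)` over arguments in `α`. -/
structure Atom (α : Type) where
  pred : Pred
  args : List α
deriving DecidableEq

namespace Atom

/-- The number of arguments is the arity of the predicate. -/
def WF {α : Type} (a : Atom α) : Prop := a.args.length = a.pred.arity

/-- Replace every argument `x` by `f x`. -/
def map {α β : Type} (f : α → β) (a : Atom α) : Atom β := ⟨a.pred, a.args.map f⟩

def equivProd (α : Type) : Atom α ≃ Pred × List α where
  toFun a := (a.pred, a.args)
  invFun p := ⟨p.1, p.2⟩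
  left_inv _ := rfl
  right_inv _ := rfl

end Atom

instance {α : Type} [Denumerable α] : Denumerable (Atom α) :=
  Denumerable.ofEquiv _ (Atom.equivProd α)

/-- The data of a rule `∀ w x. [β(w, x) → ⋁ᵢ ∃ yᵢ. ηᵢ(xᵢ, yᵢ)]`. The quantified variables are
determined by `β` and the `ηᵢ`: `w, x` are the variables of `β`, the frontier `x` consists of those
that also occur in some `ηᵢ`, and `yᵢ` consists of the variables of `ηᵢ` that do not occur in `β`.
The head disjuncts are numbered from `0`. -/
structure Rule where
  body : List (Atom Var)
  heads : List (List (Atom Var))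
deriving DecidableEq

namespace Rule

def equivProd : Rule ≃ List (Atom Var) × List (List (Atom Var)) where
  toFun r := (r.body, r.heads)
  invFun p := ⟨p.1, p.2⟩
  left_inv _ := rfl
  right_inv _ := rfl

/-- The variables of a conjunction of atoms, without repetitions. -/
def vars (φ : List (Atom Var)) : List Var := (φ.flatMap Atom.args).dedup

def bodyVars (r : Rule) : List Var := vars r.body

/-- The `i`-th head disjunct. -/
def head (r : Rule) (i : ℕ) : List (Atom Var) := r.heads.getD i []

/-- The number of head disjuncts. -/
def branching (r : Rule) : ℕ := r.heads.length

/-- The frontier, listed in a fixed order. -/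
def frontier (r : Rule) : List Var := r.bodyVars.filter (fun x => x ∈ vars r.heads.flatten)

/-- The existentially quantified variables of a head disjunct `η` of the rule. -/
def exVars (r : Rule) (η : List (Atom Var)) : List Var := (vars η).filter (fun y => y ∉ r.bodyVars)

/-- The data is that of a disjunctive existential rule. -/
structure WF (r : Rule) : Prop where
  body_ne : r.body ≠ []
  heads_ne : r.heads ≠ []
  head_ne : ∀ η ∈ r.heads, η ≠ []
  body_wf : ∀ a ∈ r.body, a.WF
  head_wf : ∀ η ∈ r.heads, ∀ a ∈ η, a.WF
  exVars_disjoint : r.heads.Pairwise fun η η' => ∀ y ∈ r.exVars η, y ∉ r.exVars η'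

def Generating (r : Rule) : Prop := ∃ η ∈ r.heads, r.exVars η ≠ []

def Deterministic (r : Rule) : Prop := r.branching = 1

def Datalog (r : Rule) : Prop := r.Deterministic ∧ ¬ r.Generating

end Rule

instance : Denumerable Rule := Denumerable.ofEquiv _ Rule.equivProd

/-- Ground terms. The function symbols are the Skolem symbols: the triple `f = (r, i, y)` is the
function symbol that is unique for the rule `r`, its `i`-th head disjunct and the variable `y`. -/
inductive GTerm where
  | const (c : ℕ)
  | func (f : Rule × ℕ × Var) (ts : List GTerm)

/-! An effective bijective numbering of ground terms. -/

namespace GTerm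

def toNat : GTerm → ℕ
  | const c => 2 * c
  | func f ts =>
    2 * Encodable.encode ((f, ts.map toNat) : (Rule × ℕ × Var) × List ℕ) + 1

theorem le_encode_of_mem {m : ℕ} {l : List ℕ} (h : m ∈ l) : m ≤ Encodable.encode l := by
  induction l with
  | nil => simp at h
  | cons a l ih =>
    rw [Encodable.encode_list_cons]
    rcases List.mem_cons.1 h with rfl | h
    · exact (Nat.left_le_pair _ _).trans (Nat.le_succ _)
    · exact (ih h).trans ((Nat.right_le_pair _ _).trans (Nat.le_succ _))

theorem le_of_mem_ofNat {m k : ℕ}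
    (h : m ∈ (Denumerable.ofNat ((Rule × ℕ × Var) × List ℕ) k).2) : m ≤ k := by
  have h1 := le_encode_of_mem h
  have h2 : Encodable.encode (Denumerable.ofNat ((Rule × ℕ × Var) × List ℕ) k) = k :=
    Denumerable.encode_ofNat k
  rw [Encodable.encode_prod_val] at h2
  exact h1.trans ((Nat.right_le_pair _ _).trans h2.le)

def ofNat (n : ℕ) : GTerm :=
  if n % 2 = 0 then const (n / 2)
  else
    func (Denumerable.ofNat ((Rule × ℕ × Var) × List ℕ) (n / 2)).1
      ((Denumerable.ofNat ((Rule × ℕ × Var) × List ℕ) (n / 2)).2.attach.map fun m => ofNat m.1)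
termination_by n
decreasing_by
  have := le_of_mem_ofNat m.2
  omega

theorem ofNat_toNat : ∀ t : GTerm, ofNat t.toNat = t
  | const c => by rw [toNat, ofNat]; simp
  | func f ts => by
    have ih : ∀ t ∈ ts, ofNat t.toNat = t := fun t _ => ofNat_toNat t
    rw [toNat, ofNat]
    have h1 : ∀ k : ℕ, (2 * k + 1) / 2 = k := fun k => by omega
    have h2 : ∀ k : ℕ, ¬ (2 * k + 1) % 2 = 0 := fun k => by omega
    rw [if_neg (h2 _), List.attach_map_val (f := ofNat)]
    simp only [h1, Denumerable.ofNat_encode, List.map_map]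
    congr 1
    conv_rhs => rw [← List.map_id ts]
    exact List.map_congr_left ih

theorem toNat_ofNat (n : ℕ) : (ofNat n).toNat = n := by
  induction n using Nat.strong_induction_on with
  | _ n ih =>
    rw [ofNat]
    split_ifs with h
    · rw [toNat]; omega
    · rw [toNat, List.attach_map_val (f := ofNat), List.map_map]
      have : (Denumerable.ofNat ((Rule × ℕ × Var) × List ℕ) (n / 2)).2.map (toNat ∘ ofNat)
          = (Denumerable.ofNat ((Rule × ℕ × Var) × List ℕ) (n / 2)).2 := by
        refine (List.map_congr_left fun m hm => ih m ?_).trans (List.map_id _)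
        have := le_of_mem_ofNat hm
        omega
      rw [this]
      have h2 : Encodable.encode (Denumerable.ofNat ((Rule × ℕ × Var) × List ℕ) (n / 2)) = n / 2 :=
        Denumerable.encode_ofNat _
      rw [Prod.mk.eta, h2]
      omega

def equivNat : GTerm ≃ ℕ := ⟨toNat, ofNat, ofNat_toNat, toNat_ofNat⟩

end GTerm

instance : Denumerable GTerm := Denumerable.mk' GTerm.equivNat

/-- Facts are variable-free atoms (well-formed ones satisfy `Atom.WF`). -/
abbrev Fact := Atom GTerm

/-- The number of arguments of the Skolem symbol `(r, i, y)` is the length of the frontier of `r`,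
and it occurs in the skolemization of a rule set `R` iff `r ∈ R` and `y` is existentially
quantified in the `i`-th head disjunct of `r`. The (ground) `R`-terms are built from these symbols
and constants. -/
inductive IsRTerm (R : Set Rule) : GTerm → Prop
  | const (c : ℕ) : IsRTerm R (GTerm.const c)
  | func (r : Rule) (i : ℕ) (y : Var) (ts : List GTerm) (hr : r ∈ R) (hi : i < r.branching)
      (hy : y ∈ r.exVars (r.head i)) (hlen : ts.length = r.frontier.length)
      (hts : ∀ t ∈ ts, IsRTerm R t) : IsRTerm R (GTerm.func (r, i, y) ts)

/-- The data of a trigger: a rule and a substitution `[x₁ / t₁, …, xₙ / tₙ]`. -/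
structure Trigger where
  rule : Rule
  subst : List (Var × GTerm)

namespace Trigger

def equivProd : Trigger ≃ Rule × List (Var × GTerm) where
  toFun l := (l.rule, l.subst)
  invFun p := ⟨p.1, p.2⟩
  left_inv _ := rfl
  right_inv _ := rfl

/-- `l` is an `R`-trigger: its rule is in `R`, its substitution is a well-defined function whose
domain is the set of body variables, and its range consists of `R`-terms. -/
structure IsRTrigger (R : Set Rule) (l : Trigger) : Prop where
  rule_mem : l.rule ∈ R
  nodup : (l.subst.map Prod.fst).Nodup
  dom : ∀ x, x ∈ l.subst.map Prod.fst ↔ x ∈ l.rule.bodyVars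
  range : ∀ p ∈ l.subst, IsRTerm R p.2

/-- `l` is a trigger with the rule `r`. -/
structure IsTriggerWith (r : Rule) (l : Trigger) : Prop where
  rule_eq : l.rule = r
  nodup : (l.subst.map Prod.fst).Nodup
  dom : ∀ x, x ∈ l.subst.map Prod.fst ↔ x ∈ l.rule.bodyVars

/-- The value of the substitution at `x`; it is only used at variables of the domain. -/
def val (l : Trigger) (x : Var) : GTerm := (l.subst.lookup x).getD (GTerm.const 0)

/-- The trigger `(r, σ)` is loaded for `F` if `body(r)σ ⊆ F`. -/
def Loaded (l : Trigger) (F : Set Fact) : Prop := ∀ a ∈ l.rule.body, a.map l.val ∈ F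

/-- The trigger `(r, σ)` is obsolete for `F` if some `τ` that extends `σ` maps some head disjunct
into `F`. -/
def Obsolete (l : Trigger) (F : Set Fact) : Prop :=
  ∃ τ : Var → GTerm, (∀ x ∈ l.rule.bodyVars, τ x = l.val x) ∧
    ∃ i < l.rule.branching, ∀ a ∈ l.rule.head i, a.map τ ∈ F

/-- The substitution `σ`, extended to the Skolem terms of `y ∈ yᵢ`: these are the terms
`f(x)σ` with `f` the Skolem symbol `(r, i, y)` and `x` the frontier of `r`. -/
def skolemVal (l : Trigger) (i : ℕ) (y : Var) : GTerm :=
  if y ∈ l.rule.bodyVars then l.val y else GTerm.func (l.rule, i, y) (l.rule.frontier.map l.val)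

/-- The output `out_i`: the `i`-th head disjunct of the skolemized rule under the substitution. -/
def out (l : Trigger) (i : ℕ) : Set Fact := {A | ∃ a ∈ l.rule.head i, A = a.map (l.skolemVal i)}

end Trigger

instance : Denumerable Trigger := Denumerable.ofEquiv _ Trigger.equivProd

/-- `F` satisfies the rule `r`: every trigger with `r` is not loaded or is obsolete. -/
def Satisfies (F : Set Fact) (r : Rule) : Prop :=
  ∀ l : Trigger, l.IsTriggerWith r → l.Loaded F → l.Obsolete F

/-- The data of a knowledge base: a rule set and a database. -/
structure KB where
  rules : Set Rule
  db : Set Fact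

/-- The rules are disjunctive existential rules, and the database is a function-free fact set. -/
structure KB.WF (K : KB) : Prop where
  rule_wf : ∀ r ∈ K.rules, r.WF
  fact_wf : ∀ A ∈ K.db, A.WF
  function_free : ∀ A ∈ K.db, ∀ t ∈ A.args, ∃ c, t = GTerm.const c

/-- Chase trees of a knowledge base. -/
structure ChaseTree (K : KB) where
  V : Type
  E : V → V → Prop
  factLabel : V → Set Fact
  /-- The trigger-label of non-root vertices; its value at the root is irrelevant. -/
  trigLabel : V → Trigger
  root : V
  /-- `(V, E)` is a directed tree with the given root. -/
  root_no_parent : ∀ v, ¬ E v root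
  parent_unique : ∀ u v w, E u w → E v w → u = v
  reachable : ∀ v, Relation.ReflTransGen E root v
  factLabel_root : factLabel root = K.db
  /-- Every non-leaf vertex expands an applicable trigger; datalog rules have priority. -/
  step : ∀ v, (∃ w, E v w) → ∃ l : Trigger, l.IsRTrigger K.rules ∧
    l.Loaded (factLabel v) ∧ ¬ l.Obsolete (factLabel v) ∧
    (¬ l.rule.Datalog → ∀ r ∈ K.rules, r.Datalog → Satisfies (factLabel v) r) ∧
    ∃ c : Fin l.rule.branching → V, Function.Injective c ∧ (∀ w, E v w ↔ ∃ i, w = c i) ∧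
      ∀ i, factLabel (c i) = factLabel v ∪ l.out i ∧ trigLabel (c i) = l
  leaf : ∀ v, (¬ ∃ w, E v w) → ∀ r ∈ K.rules, Satisfies (factLabel v) r
  /-- Fairness. -/
  fair : ∀ l : Trigger, l.IsRTrigger K.rules → ∀ v, l.Loaded (factLabel v) →
    ∃ k : ℕ, ∀ u, (∃ p : ℕ → V, p 0 = v ∧ p k = u ∧ ∀ j < k, E (p j) (p (j + 1))) →
      l.Obsolete (factLabel u)

/-- A head-choice for `R` (head disjuncts are numbered from `0`). -/
def IsHeadChoice (R : Set Rule) (hc : Rule → ℕ) : Prop := ∀ r ∈ R, hc r < r.branching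

namespace ChaseTree

variable {K : KB}

/-- A branch: a maximal path that starts at the root, as a finite or infinite sequence of vertices
(`b n = none` if the sequence has at most `n` elements). -/
structure IsBranch (T : ChaseTree K) (b : ℕ → Option T.V) : Prop where
  start : b 0 = some T.root
  edge : ∀ n w, b (n + 1) = some w → ∃ v, b n = some v ∧ T.E v w
  maximal : ∀ n v, b n = some v → b (n + 1) = none → ¬ ∃ w, T.E v w

/-- `b` is the branch of `T` that follows the head-choice `hc`. -/
def IsHCBranch (T : ChaseTree K) (hc : Rule → ℕ) (b : ℕ → Option T.V) : Prop :=
  T.IsBranch b ∧ ∀ n v w, b n = some v → b (n + 1) = some w →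
    T.factLabel w = T.factLabel v ∪ (T.trigLabel w).out (hc (T.trigLabel w).rule)

end ChaseTree

/-- The trigger `l` is g-unblockable for `K` and `hc`: whenever it is loaded for some vertex of the
`hc`-branch of a chase tree of `K`, its output according to `hc` is contained in the fact-label of
some vertex of this branch. -/
def GUnblockable (K : KB) (hc : Rule → ℕ) (l : Trigger) : Prop :=
  ∀ (T : ChaseTree K) (b : ℕ → Option T.V), T.IsHCBranch hc b →
    ∀ n v, b n = some v → l.Loaded (T.factLabel v) →
      ∃ m u, b m = some u ∧ l.out (hc l.rule) ⊆ T.factLabel u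

/-- Inputs of the decision problem: a finite rule set, a finite database, a head-choice (as a list
of pairs of a rule and the number of a head disjunct) and a trigger. -/
structure Input where
  rules : List Rule
  db : List Fact
  choice : List (Rule × ℕ)
  trigger : Trigger

namespace Input

def equivProd : Input ≃ List Rule × List Fact × List (Rule × ℕ) × Trigger where
  toFun I := (I.rules, I.db, I.choice, I.trigger)
  invFun p := ⟨p.1, p.2.1, p.2.2.1, p.2.2.2⟩
  left_inv _ := rfl
  right_inv _ := rfl

def kb (I : Input) : KB := ⟨{r | r ∈ I.rules}, {A | A ∈ I.db}⟩

def hc (I : Input) (r : Rule) : ℕ := (I.choice.lookup r).getD 0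

/-- The input consists of a knowledge base, a head-choice for its rule set `R`, given as a list that
mentions exactly the rules in `R`, each of them once, and an `R`-trigger. -/
structure Valid (I : Input) : Prop where
  kb_wf : I.kb.WF
  choice_nodup : (I.choice.map Prod.fst).Nodup
  choice_dom : ∀ r, r ∈ I.choice.map Prod.fst ↔ r ∈ I.rules
  choice_range : IsHeadChoice I.kb.rules I.hc
  trigger_wf : I.trigger.IsRTrigger I.kb.rules

end Input

instance : Denumerable Input := Denumerable.ofEquiv _ Input.equivProd

end DisjChase

namespace DisjChase

/-! The proof is a reduction from halting. A program `c` with undecidable halting set is axiomatised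
by Horn clauses over lists of naturals; the input `n` enters only through the database. Every clause
becomes a rule with a single head disjunct and an existential variable, so nothing branches and no
rule is datalog. The trigger `goalTrigger` is loaded exactly when the constant `0` is marked as
halted. The database contains a goal fact that makes this trigger obsolete from the start, so the
chase sequence `chaseSeq` never produces its Skolem output (`chaseSeq_goal`). Thus the trigger is
g-unblockable only if it is never loaded there, which amounts to `c` diverging on `n`
(`gUnblockable_haltInput_iff`). If `c` diverges, the facts on every `hc`-branch map homomorphically
into `Standard n`, a model without halted elements (`ChaseTree.IsHCBranch.interp`,
`standard_isModel`). If `c` halts, the fair sequence `chaseSeq` is the branch of a genuine chase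
tree and its union is a model (`chaseSeq_isModel`). Every model of the clauses contains the whole
computation (`Rep.exists_graph`), so the halted fact is derived at a finite stage. -/

theorem Atom.map_map {α β γ : Type} (f : α → β) (g : β → γ) (a : Atom α) :
    (a.map f).map g = a.map (g ∘ f) := by
  simp [Atom.map]

theorem Atom.map_congr {α β : Type} {f g : α → β} {a : Atom α} (h : ∀ x ∈ a.args, f x = g x) :
    a.map f = a.map g := by
  simpa [Atom.map] using h

namespace Rule

theorem mem_vars {φ : List (Atom Var)} {x : Var} : x ∈ vars φ ↔ ∃ a ∈ φ, x ∈ a.args := by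
  simp [vars]

theorem head_mem_heads {r : Rule} {i : ℕ} {a : Atom Var} (ha : a ∈ r.head i) :
    r.head i ∈ r.heads := by
  unfold head at *
  by_cases h : i < r.heads.length
  · rw [List.getD_eq_getElem _ _ h]
    exact List.getElem_mem h
  · rw [List.getD_eq_default _ _ (by omega)] at ha
    simp at ha

theorem mem_frontier {r : Rule} {i : ℕ} {a : Atom Var} {x : Var} (ha : a ∈ r.head i)
    (hx : x ∈ a.args) (hb : x ∈ r.bodyVars) : x ∈ r.frontier := by
  refine List.mem_filter.2 ⟨hb, decide_eq_true (mem_vars.2 ⟨a, ?_, hx⟩)⟩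
  exact List.mem_flatten.2 ⟨_, head_mem_heads ha, ha⟩

theorem frontier_subset {r : Rule} {x : Var} (hx : x ∈ r.frontier) : x ∈ r.bodyVars :=
  List.mem_of_mem_filter hx

end Rule

/-! ### Homomorphisms from `hc`-branches into models -/

/-- `M` is a model of the rules in which, for every rule, the head disjunct selected by `hc` is
satisfied. -/
def IsModel {D : Type} (R : Set Rule) (hc : Rule → ℕ) (M : Set (Atom D)) : Prop :=
  ∀ r ∈ R, ∀ σ : Var → D, (∀ a ∈ r.body, a.map σ ∈ M) →
    ∃ τ : Var → D, (∀ x ∈ r.bodyVars, τ x = σ x) ∧ ∀ a ∈ r.head (hc r), a.map τ ∈ M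

section Interpretation

variable {D : Type} [Inhabited D]

open Classical in
/-- An assignment that satisfies the `i`-th head disjunct of `r` and has the given values at the
frontier, if there is one. -/
noncomputable def witness (M : Set (Atom D)) (r : Rule) (i : ℕ) (ds : List D) : Var → D :=
  if h : ∃ τ : Var → D, r.frontier.map τ = ds ∧ ∀ a ∈ r.head i, a.map τ ∈ M then h.choose
  else fun _ => default

theorem witness_spec {M : Set (Atom D)} {r : Rule} {i : ℕ} {ds : List D}
    (h : ∃ τ : Var → D, r.frontier.map τ = ds ∧ ∀ a ∈ r.head i, a.map τ ∈ M) :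
    r.frontier.map (witness M r i ds) = ds ∧ ∀ a ∈ r.head i, a.map (witness M r i ds) ∈ M := by
  rw [witness, dif_pos h]
  exact h.choose_spec

/-- The interpretation of ground terms in a model: Skolem symbols are interpreted by witnesses. -/
noncomputable def GTerm.interp (c₀ : ℕ → D) (M : Set (Atom D)) : GTerm → D
  | const c => c₀ c
  | func f ts => witness M f.1 f.2.1 (ts.map (GTerm.interp c₀ M)) f.2.2

/-- A Skolem term is interpreted by the value of `witness` at its variable, and `witness` reproduces
the given frontier values. So the interpreted output is the image of the head disjunct under one
satisfying assignment. -/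
theorem Trigger.out_interp {R : Set Rule} {hc : Rule → ℕ} {M : Set (Atom D)}
    (hM : IsModel R hc M) (c₀ : ℕ → D) {l : Trigger} (hl : l.rule ∈ R)
    (hb : ∀ a ∈ l.rule.body, (a.map l.val).map (GTerm.interp c₀ M) ∈ M) :
    ∀ A ∈ l.out (hc l.rule), A.map (GTerm.interp c₀ M) ∈ M := by
  rintro _ ⟨a, ha, rfl⟩
  simp only [Atom.map_map] at hb
  obtain ⟨τ, hτ, hhead⟩ := hM _ hl _ hb
  have hτf : l.rule.frontier.map τ = (l.rule.frontier.map l.val).map (GTerm.interp c₀ M) := by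
    rw [List.map_map]
    exact List.map_congr_left fun x hx => hτ x (Rule.frontier_subset hx)
  obtain ⟨h1, h2⟩ := witness_spec ⟨τ, hτf, hhead⟩
  rw [Atom.map_map]
  convert h2 a ha using 1
  refine Atom.map_congr fun y hy => ?_
  simp only [Function.comp, Trigger.skolemVal]
  split_ifs with hyb
  · have hyf := Rule.mem_frontier ha hy hyb
    exact (List.map_inj_left.1 (h1.trans List.map_map) y hyf).symm
  · rw [GTerm.interp]

/-- The fact labels of an `hc`-branch map homomorphically into every model of the database. -/
theorem ChaseTree.IsHCBranch.interp {K : KB} {hc : Rule → ℕ} {T : ChaseTree K}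
    {b : ℕ → Option T.V} (hb : T.IsHCBranch hc b) {M : Set (Atom D)} (hM : IsModel K.rules hc M)
    {c₀ : ℕ → D} (hD : ∀ A ∈ K.db, A.map (GTerm.interp c₀ M) ∈ M) :
    ∀ n v, b n = some v → ∀ A ∈ T.factLabel v, A.map (GTerm.interp c₀ M) ∈ M := by
  intro n
  induction n with
  | zero =>
    intro v hv
    obtain rfl : T.root = v := by simpa [hb.1.start] using hv
    rw [T.factLabel_root]
    exact hD
  | succ n ih =>
    intro w hw A hA
    obtain ⟨v, hv, hE⟩ := hb.1.edge n w hw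
    obtain ⟨l, hl, hload, -, -, c, -, hc1, hc2⟩ := T.step v ⟨w, hE⟩
    obtain ⟨i, rfl⟩ := (hc1 w).1 hE
    -- On an `hc`-branch the new facts come from the disjunct chosen by `hc`, whatever the index `i`
    -- of the child; this is the only disjunct that the model has to satisfy.
    rw [hb.2 n v _ hv hw, (hc2 i).2] at hA
    rcases hA with hA | hA
    · exact ih v hv A hA
    · exact Trigger.out_interp hM c₀ hl.rule_mem (fun a ha => ih v hv _ (hload a ha)) A hA

end Interpretation

/-! ### A canonical fair chase for deterministic generating rules -/

section Chase

variable (K : KB)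

/-- `l` may be applied to `F`, apart from the priority of datalog rules. -/
def Applicable (F : Set Fact) (l : Trigger) : Prop :=
  l.IsRTrigger K.rules ∧ l.Loaded F ∧ ¬ l.Obsolete F

/-- The applicable trigger with the least number, if there is one. -/
noncomputable def leastTrigger (F : Set Fact) : Trigger :=
  Classical.epsilon fun l =>
    Applicable K F l ∧ ∀ l', Applicable K F l' → Encodable.encode l ≤ Encodable.encode l'

/-- Apply the least applicable trigger, choosing the first head disjunct. -/
def chaseStep (F : Set Fact) : Set Fact :=
  F ∪ {A | (∃ l, Applicable K F l) ∧ A ∈ (leastTrigger K F).out 0}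

/-- The sequence becomes constant once no trigger applies; `Runs` marks the stages that are really
reached. -/
def chaseSeq : ℕ → Set Fact
  | 0 => K.db
  | n + 1 => chaseStep K (chaseSeq n)

/-- The chase sequence does not stop before stage `n`. -/
def Runs (n : ℕ) : Prop := ∀ j < n, ∃ l, Applicable K (chaseSeq K j) l

variable {K}

theorem leastTrigger_spec {F : Set Fact} (h : ∃ l, Applicable K F l) :
    Applicable K F (leastTrigger K F) ∧ ∀ l', Applicable K F l' →
      Encodable.encode (leastTrigger K F) ≤ Encodable.encode l' := by
  refine Classical.epsilon_spec (p := fun l => Applicable K F l ∧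
    ∀ l', Applicable K F l' → Encodable.encode l ≤ Encodable.encode l') ?_
  obtain ⟨l, hl, hmin⟩ := (measure (Encodable.encode : Trigger → ℕ)).wf.has_min
    {l | Applicable K F l} h
  exact ⟨l, hl, fun l' hl' => not_lt.1 (hmin l' hl')⟩

theorem chaseStep_of_applicable {F : Set Fact} (h : ∃ l, Applicable K F l) :
    chaseStep K F = F ∪ (leastTrigger K F).out 0 := by
  simp [chaseStep, h]

theorem chaseStep_of_not_applicable {F : Set Fact} (h : ¬ ∃ l, Applicable K F l) :
    chaseStep K F = F := by
  simp [chaseStep, h]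

theorem chaseSeq_mono : Monotone (chaseSeq K) :=
  monotone_nat_of_le_succ fun _ _ hA => Or.inl hA

theorem Runs.of_le {m n : ℕ} (h : Runs K n) (hm : m ≤ n) : Runs K m :=
  fun j hj => h j (hj.trans_le hm)

/-- Stages after termination repeat the last real one, so a fact found at any stage is found at a
vertex of the chase tree. -/
theorem exists_runs (n : ℕ) : ∃ m, Runs K m ∧ chaseSeq K m = chaseSeq K n := by
  induction n with
  | zero => exact ⟨0, fun j hj => by omega, rfl⟩
  | succ n ih =>
    obtain ⟨m, hm, he⟩ := ih
    by_cases h : ∃ l, Applicable K (chaseSeq K m) l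
    · refine ⟨m + 1, fun j hj => ?_, by rw [chaseSeq, chaseSeq, he]⟩
      rcases Nat.lt_succ_iff_lt_or_eq.1 hj with hj | rfl
      · exact hm j hj
      · exact h
    · refine ⟨m, hm, ?_⟩
      rw [chaseSeq, ← he, chaseStep_of_not_applicable h]

theorem Trigger.Loaded.mono {l : Trigger} {F G : Set Fact} (h : l.Loaded F) (hFG : F ⊆ G) :
    l.Loaded G :=
  fun a ha => hFG (h a ha)

theorem Trigger.Obsolete.mono {l : Trigger} {F G : Set Fact} (h : l.Obsolete F) (hFG : F ⊆ G) :
    l.Obsolete G := by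
  obtain ⟨τ, h1, i, hi, h2⟩ := h
  exact ⟨τ, h1, i, hi, fun a ha => hFG (h2 a ha)⟩

theorem Trigger.obsolete_of_out_subset {l : Trigger} {F : Set Fact} {i : ℕ}
    (hi : i < l.rule.branching) (h : l.out i ⊆ F) : l.Obsolete F :=
  ⟨l.skolemVal i, fun x hx => by simp [skolemVal, hx], i, hi, fun a ha => h ⟨a, ha, rfl⟩⟩

/-- All terms of a fact set are `R`-terms. -/
def IsRFactSet (R : Set Rule) (F : Set Fact) : Prop := ∀ A ∈ F, ∀ t ∈ A.args, IsRTerm R t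

/-- `Satisfies` speaks of all triggers, but the chase only applies `R`-triggers. The gap closes
because every domain variable occurs in a body atom, so its value is an argument of a fact in `F`.
-/
theorem Trigger.IsTriggerWith.isRTrigger {R : Set Rule} {F : Set Fact} (hF : IsRFactSet R F)
    {r : Rule} (hr : r ∈ R) {l : Trigger} (hl : l.IsTriggerWith r) (h : l.Loaded F) :
    l.IsRTrigger R := by
  refine ⟨hl.rule_eq ▸ hr, hl.nodup, fun x => by rw [hl.dom x], fun p hp => ?_⟩
  have hx : p.1 ∈ l.rule.bodyVars := (hl.dom _).1 (List.mem_map_of_mem hp)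
  obtain ⟨a, ha, hxa⟩ := Rule.mem_vars.1 hx
  have hval : l.val p.1 = p.2 := by
    have : l.subst.lookup p.1 = some p.2 := by
      have hnd := hl.nodup
      revert hp hnd
      induction l.subst with
      | nil => simp
      | cons q s ih =>
        intro hp hnd
        rw [List.map_cons, List.nodup_cons] at hnd
        rcases List.mem_cons.1 hp with rfl | hp
        · simp [List.lookup]
        · have hne : p.1 ≠ q.1 := fun he => hnd.1 (he ▸ List.mem_map_of_mem hp)
          rw [List.lookup, beq_false_of_ne hne]
          exact ih hp hnd.2
    rw [Trigger.val, this, Option.getD_some]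
  rw [← hval]
  exact hF _ (h a ha) _ (List.mem_map_of_mem hxa)

theorem Trigger.IsRTrigger.val_isRTerm {R : Set Rule} {l : Trigger} (hl : l.IsRTrigger R)
    (x : Var) :
    IsRTerm R (l.val x) := by
  rw [Trigger.val]
  cases h : l.subst.lookup x with
  | none => exact IsRTerm.const 0
  | some t =>
    obtain ⟨l₁, l₂, h, -⟩ := List.lookup_eq_some_iff.1 h
    exact hl.range (x, t) (by simp [h])

theorem Trigger.IsRTrigger.out_isRFactSet {R : Set Rule} {l : Trigger} (hl : l.IsRTrigger R)
    {i : ℕ} (hi : i < l.rule.branching) : IsRFactSet R (l.out i) := by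
  rintro _ ⟨a, ha, rfl⟩ t ht
  obtain ⟨y, hy, rfl⟩ := List.mem_map.1 ht
  rw [skolemVal]
  split_ifs with hb
  · exact hl.val_isRTerm y
  · refine IsRTerm.func _ _ _ _ hl.rule_mem hi ?_ (by simp) fun t ht => ?_
    · exact List.mem_filter.2 ⟨Rule.mem_vars.2 ⟨a, ha, hy⟩, decide_eq_true hb⟩
    · obtain ⟨x, -, rfl⟩ := List.mem_map.1 ht
      exact hl.val_isRTerm x

theorem KB.WF.isRFactSet_db (hK : K.WF) : IsRFactSet K.rules K.db := by
  intro A hA t ht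
  obtain ⟨c, rfl⟩ := hK.function_free A hA t ht
  exact IsRTerm.const c

theorem chaseSeq_induction {P : Set Fact → Prop} (h0 : P K.db)
    (hs : ∀ F l, P F → Applicable K F l → P (F ∪ l.out 0)) (n : ℕ) : P (chaseSeq K n) := by
  induction n with
  | zero => exact h0
  | succ n ih =>
    rw [chaseSeq]
    by_cases h : ∃ l, Applicable K (chaseSeq K n) l
    · rw [chaseStep_of_applicable h]
      exact hs _ _ ih (leastTrigger_spec h).1
    · rwa [chaseStep_of_not_applicable h]

theorem chaseSeq_isRFactSet (hK : K.WF) (hdet : ∀ r ∈ K.rules, r.Deterministic) (n : ℕ) :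
    IsRFactSet K.rules (chaseSeq K n) := by
  refine chaseSeq_induction hK.isRFactSet_db (fun F l hF hl A hA => ?_) n
  rcases hA with hA | hA
  · exact hF A hA
  · exact hl.1.out_isRFactSet (by rw [hdet _ hl.1.rule_mem]; exact one_pos) A hA

/-- If `l` stayed applicable forever, every later stage would apply a trigger numbered at most as
high as `l`. An applied trigger is obsolete from then on, so these triggers are pairwise distinct,
which the bound forbids. -/
theorem chaseSeq_fair (hdet : ∀ r ∈ K.rules, r.Deterministic) {l : Trigger}
    (hl : l.IsRTrigger K.rules) {n : ℕ} (hload : l.Loaded (chaseSeq K n)) :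
    ∃ k, l.Obsolete (chaseSeq K (n + k)) := by
  by_contra! hno
  have happ : ∀ k, Applicable K (chaseSeq K (n + k)) l := fun k =>
    ⟨hl, hload.mono (chaseSeq_mono (Nat.le_add_right _ _)), hno k⟩
  let p : ℕ → Trigger := fun k => leastTrigger K (chaseSeq K (n + k))
  have hp : ∀ k, Applicable K (chaseSeq K (n + k)) (p k) := fun k =>
    (leastTrigger_spec ⟨l, happ k⟩).1
  have hle : ∀ k, Encodable.encode (p k) ≤ Encodable.encode l := fun k =>
    (leastTrigger_spec ⟨l, happ k⟩).2 l (happ k)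
  have hobs : ∀ k, (p k).Obsolete (chaseSeq K (n + (k + 1))) := fun k => by
    refine Trigger.obsolete_of_out_subset (i := 0) ?_ ?_
    · rw [hdet _ (hp k).1.rule_mem]
      exact one_pos
    · rw [← add_assoc, chaseSeq, chaseStep_of_applicable ⟨l, happ k⟩]
      exact Set.subset_union_right
  have hne : ∀ j k, j < k → p j ≠ p k := fun j k hjk he =>
    (hp k).2.2 (he ▸ (hobs j).mono (chaseSeq_mono (by omega)))
  have hinj : Function.Injective
      fun k => (⟨Encodable.encode (p k), Nat.lt_succ_of_le (hle k)⟩ :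
        Fin (Encodable.encode l + 1)) := by
    intro j k hjk
    have he : p j = p k := Encodable.encode_injective (Fin.mk.inj hjk)
    rcases lt_trichotomy j k with h | h | h
    · exact absurd he (hne j k h)
    · exact h
    · exact absurd he.symm (hne k j h)
  exact not_injective_infinite_finite _ hinj

/-- The chase sequence as a chase tree; it has a single branch. -/
noncomputable def chaseSeqTree (hK : K.WF) (hdet : ∀ r ∈ K.rules, r.Deterministic)
    (hgen : ∀ r ∈ K.rules, r.Generating) : ChaseTree K where
  V := {n // Runs K n}
  E u v := v.1 = u.1 + 1
  factLabel v := chaseSeq K v.1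
  -- Stage `n + 1` arises from the trigger chosen at stage `n`; the truncated subtraction only
  -- matters at the root, whose label is irrelevant.
  trigLabel v := leastTrigger K (chaseSeq K (v.1 - 1))
  root := ⟨0, fun j hj => by omega⟩
  root_no_parent v h := by simp at h
  parent_unique u v w h1 h2 := Subtype.ext (by omega)
  reachable := by
    rintro ⟨n, hn⟩
    induction n with
    | zero => exact .refl
    | succ n ih => exact .tail (ih (hn.of_le n.le_succ)) rfl
  factLabel_root := rfl
  step := by
    rintro v ⟨w, hw⟩
    have hr : Runs K (v.1 + 1) := hw ▸ w.2
    have hv := hr v.1 (Nat.lt_succ_self _)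
    have hl := (leastTrigger_spec hv).1
    have hsub : Subsingleton (Fin (leastTrigger K (chaseSeq K v.1)).rule.branching) := by
      rw [hdet _ hl.1.rule_mem]
      infer_instance
    -- Datalog priority is vacuous, since every rule is generating.
    refine ⟨leastTrigger K (chaseSeq K v.1), hl.1, hl.2.1, hl.2.2,
      fun _ r hr hd => absurd (hgen r hr) hd.2, fun _ => ⟨v.1 + 1, hr⟩,
      fun i j _ => Subsingleton.elim i j, fun u => ?_, fun i => ⟨?_, rfl⟩⟩
    · have h0 : 0 < (leastTrigger K (chaseSeq K v.1)).rule.branching := by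
        rw [hdet _ hl.1.rule_mem]
        exact one_pos
      exact ⟨fun h => ⟨⟨0, h0⟩, Subtype.ext h⟩, fun ⟨_, h⟩ => h ▸ rfl⟩
    · have hi : i.1 = 0 := by
        have h1 : i.1 < 1 := i.2.trans_eq (hdet _ hl.1.rule_mem)
        omega
      rw [hi, chaseSeq, chaseStep_of_applicable hv]
  leaf := by
    intro v hv r hr l hl hload
    by_contra hobs
    have hl' := hl.isRTrigger (chaseSeq_isRFactSet hK hdet v.1) hr hload
    refine hv ⟨⟨v.1 + 1, fun j hj => ?_⟩, rfl⟩
    rcases Nat.lt_succ_iff_lt_or_eq.1 hj with hj | rfl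
    · exact v.2 j hj
    · exact ⟨l, hl', hload, hobs⟩
  fair := by
    intro l hl v hload
    obtain ⟨k, hk⟩ := chaseSeq_fair hdet hl hload
    refine ⟨k, fun u ⟨p, hp0, hpk, hp⟩ => ?_⟩
    -- Edges raise the stage by one, so a path of length `k` from `v` can only end at stage `v.1 +
    -- k`.
    have hval : ∀ j ≤ k, (p j).1 = v.1 + j := by
      intro j
      induction j with
      | zero => simp [hp0]
      | succ j ih => intro hj; rw [hp j hj, ih (by omega)]; rfl
    rwa [← hpk, hval k le_rfl]

open Classical in
/-- The branch of `chaseSeqTree`. -/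
noncomputable def chaseSeqBranch (n : ℕ) : Option {n // Runs K n} :=
  if h : Runs K n then some ⟨n, h⟩ else none

theorem chaseSeqBranch_eq_some {n : ℕ} {v : {n // Runs K n}} :
    chaseSeqBranch n = some v ↔ v.1 = n := by
  rw [chaseSeqBranch]
  constructor
  · intro h
    split_ifs at h
    cases h
    rfl
  · rintro rfl
    rw [dif_pos v.2]

theorem chaseSeqBranch_isHCBranch (hK : K.WF) (hdet : ∀ r ∈ K.rules, r.Deterministic)
    (hgen : ∀ r ∈ K.rules, r.Generating) {hc : Rule → ℕ} (hhc : ∀ r, hc r = 0) :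
    (chaseSeqTree hK hdet hgen).IsHCBranch hc chaseSeqBranch := by
  refine ⟨⟨chaseSeqBranch_eq_some.2 rfl, fun n w hw => ?_, ?_⟩, ?_⟩
  · have hw := chaseSeqBranch_eq_some.1 hw
    have hr : Runs K n := w.2.of_le (by omega)
    exact ⟨⟨n, hr⟩, chaseSeqBranch_eq_some.2 rfl, hw⟩
  · rintro n v hv hn ⟨w, hw⟩
    have hv := chaseSeqBranch_eq_some.1 hv
    have hw' : w.1 = n + 1 := hv ▸ hw
    rw [chaseSeqBranch_eq_some.2 hw'] at hn
    cases hn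
  · intro n v w hv hw
    have hv := chaseSeqBranch_eq_some.1 hv
    have hw := chaseSeqBranch_eq_some.1 hw
    have hr := w.2 n (by omega)
    change chaseSeq K w.1 = chaseSeq K v.1 ∪ (leastTrigger K (chaseSeq K (w.1 - 1))).out _
    rw [hv, hw, hhc, chaseSeq, chaseStep_of_applicable hr]
    rfl

/-- A body is finite, so its match already lies in one stage; fairness makes the resulting trigger
obsolete at a later stage. -/
theorem chaseSeq_isModel (hK : K.WF) (hdet : ∀ r ∈ K.rules, r.Deterministic) :
    IsModel K.rules (fun _ => 0) (⋃ n, chaseSeq K n) := by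
  intro r hr σ hσ
  have hbody : ∀ s : List (Atom Var), (∀ a ∈ s, a.map σ ∈ ⋃ n, chaseSeq K n) →
      ∃ n, ∀ a ∈ s, a.map σ ∈ chaseSeq K n := by
    intro s hσ
    induction s with
    | nil => exact ⟨0, by simp⟩
    | cons a s ih =>
      obtain ⟨n, hn⟩ := ih fun a ha => hσ a (List.mem_cons_of_mem _ ha)
      obtain ⟨m, hm⟩ := Set.mem_iUnion.1 (hσ a List.mem_cons_self)
      refine ⟨max n m, fun b hb => ?_⟩
      rcases List.mem_cons.1 hb with rfl | hb
      · exact chaseSeq_mono (le_max_right n m) hm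
      · exact chaseSeq_mono (le_max_left n m) (hn b hb)
  obtain ⟨n, hn⟩ := hbody r.body hσ
  let l : Trigger := ⟨r, r.bodyVars.map fun x => (x, σ x)⟩
  have hfst : l.subst.map Prod.fst = r.bodyVars := by
    simp [l, Function.comp_def]
  have hl : l.IsTriggerWith r :=
    ⟨rfl, hfst ▸ List.nodup_dedup _, fun x => by rw [hfst]⟩
  have hval : ∀ x ∈ r.bodyVars, l.val x = σ x := by
    intro x hx
    have : ∀ s : List Var, x ∈ s → (s.map fun x => (x, σ x)).lookup x = some (σ x) := by
      intro s
      induction s with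
      | nil => simp
      | cons y s ih =>
        intro h
        by_cases hxy : x = y
        · simp [hxy]
        · rw [List.map_cons, List.lookup, beq_false_of_ne hxy]
          exact ih (List.mem_of_ne_of_mem hxy h)
    rw [Trigger.val, this _ hx, Option.getD_some]
  have hload : l.Loaded (chaseSeq K n) := by
    intro a ha
    rw [Atom.map_congr fun x hx => hval x (Rule.mem_vars.2 ⟨a, ha, hx⟩)]
    exact hn a ha
  obtain ⟨k, τ, hτ, i, hi, hhead⟩ := chaseSeq_fair hdet
    (hl.isRTrigger (chaseSeq_isRFactSet hK hdet n) hr hload) hload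
  have hi0 : i = 0 := by
    have h1 : i < 1 := hi.trans_eq (hdet _ hr)
    omega
  subst hi0
  exact ⟨τ, fun x hx => (hτ x hx).trans (hval x hx),
    fun a ha => Set.mem_iUnion.2 ⟨_, hhead a ha⟩⟩

/-- For deterministic generating rules, a trigger that is loaded in the chase sequence
while its output never appears is not g-unblockable. -/
theorem not_gUnblockable_of_chaseSeq (hK : K.WF) (hdet : ∀ r ∈ K.rules, r.Deterministic)
    (hgen : ∀ r ∈ K.rules, r.Generating) {hc : Rule → ℕ} (hhc : ∀ r, hc r = 0) {l : Trigger}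
    (hload : ∃ n, l.Loaded (chaseSeq K n)) (hout : ∀ n, ¬ l.out 0 ⊆ chaseSeq K n) :
    ¬ GUnblockable K hc l := by
  intro h
  obtain ⟨n, hn⟩ := hload
  obtain ⟨m, hm, he⟩ := exists_runs (K := K) n
  obtain ⟨k, u, -, hu⟩ := h _ _ (chaseSeqBranch_isHCBranch hK hdet hgen hhc) m ⟨m, hm⟩
    (chaseSeqBranch_eq_some.2 rfl) (show l.Loaded (chaseSeq K m) from he ▸ hn)
  rw [hhc] at hu
  exact hout u.1 hu

end Chase

open Turing.ToPartrec (Code)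

/-! ### Horn clauses as generating rules -/

section Theory

/-! Predicates over lists of natural numbers: unary ones are `0` (empty list), `1` (element of the
domain), `2` (halted); binary ones are `0` (prepend a zero), `1` (increment the head of a non-empty
list), `2` (tail), `3` (input), `4` (the goal), and `codeNum c + 5` (graph of `c`); the ternary one
holds for `u, v, w` if `w` is the head of `u` followed by `v`. -/

def un {α : Type} (p : ℕ) (x : α) : Atom α := ⟨(p, 0), [x]⟩

def bin {α : Type} (p : ℕ) (x y : α) : Atom α := ⟨(p, 1), [x, y]⟩

def ter {α : Type} (x y z : α) : Atom α := ⟨(0, 2), [x, y, z]⟩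

variable {α β : Type}

@[simp] theorem map_un (f : α → β) (p : ℕ) (x : α) : (un p x).map f = un p (f x) := rfl

@[simp] theorem map_bin (f : α → β) (p : ℕ) (x y : α) :
    (bin p x y).map f = bin p (f x) (f y) := rfl

@[simp] theorem map_ter (f : α → β) (x y z : α) : (ter x y z).map f = ter (f x) (f y) (f z) := rfl

@[simp] theorem args_un (p : ℕ) (x : α) : (un p x).args = [x] := rfl

@[simp] theorem args_bin (p : ℕ) (x y : α) : (bin p x y).args = [x, y] := rfl

@[simp] theorem args_ter (x y z : α) : (ter x y z).args = [x, y, z] := rfl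

@[simp] theorem pred_un (p : ℕ) (x : α) : (un p x).pred = (p, 0) := rfl

@[simp] theorem pred_bin (p : ℕ) (x y : α) : (bin p x y).pred = (p, 1) := rfl

@[simp] theorem pred_ter (x y z : α) : (ter x y z).pred = (0, 2) := rfl

@[simp] theorem wf_un (p : ℕ) (x : α) : (un p x).WF := rfl

@[simp] theorem wf_bin (p : ℕ) (x y : α) : (bin p x y).WF := rfl

@[simp] theorem wf_ter (x y z : α) : (ter x y z).WF := rfl

/-- A Horn clause whose head may use the variable `0` that does not occur in the body. -/
structure Clause where
  body : List (Atom Var)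
  head : Atom Var

/-- The rule that asserts the head for some element `0` of the domain. -/
def Clause.rule (k : Clause) : Rule := ⟨k.body, [[k.head, un 1 0]]⟩

structure Clause.WF (k : Clause) : Prop where
  body_ne : k.body ≠ []
  body : ∀ a ∈ k.body, a.WF ∧ 0 ∉ a.args
  head : k.head.WF
  safe : ∀ x ∈ k.head.args, x = 0 ∨ ∃ a ∈ k.body, x ∈ a.args

theorem Clause.WF.zero_notMem {k : Clause} (hk : k.WF) : 0 ∉ k.rule.bodyVars := by
  intro h
  obtain ⟨a, ha, h⟩ := Rule.mem_vars.1 h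
  exact (hk.body a ha).2 h

theorem Clause.WF.rule {k : Clause} (hk : k.WF) : k.rule.WF where
  body_ne := hk.body_ne
  heads_ne := by simp [Clause.rule]
  head_ne := by simp [Clause.rule]
  body_wf a ha := (hk.body a ha).1
  head_wf := by simp [Clause.rule, hk.head]
  exVars_disjoint := by simp [Clause.rule]

/-- The conjunct `un 1 0` makes `0` existential even when the clause head does not mention it. This
is what keeps datalog rules out of the construction. -/
theorem Clause.WF.generating {k : Clause} (hk : k.WF) : k.rule.Generating := by
  refine ⟨[k.head, un 1 0], by simp [Clause.rule], List.ne_nil_of_mem (a := 0) ?_⟩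
  exact List.mem_filter.2 ⟨Rule.mem_vars.2 ⟨un 1 0, by simp⟩, decide_eq_true hk.zero_notMem⟩

def Clause.Holds {D : Type} (M : Set (Atom D)) (k : Clause) : Prop :=
  ∀ σ : Var → D, (∀ a ∈ k.body, a.map σ ∈ M) →
    ∃ d, k.head.map (Function.update σ 0 d) ∈ M ∧ un 1 d ∈ M

theorem isModel_of_holds {D : Type} {M : Set (Atom D)} {ks : List Clause} {hc : Rule → ℕ}
    (hhc : ∀ r, hc r = 0) (hwf : ∀ k ∈ ks, k.WF) (h : ∀ k ∈ ks, k.Holds M) :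
    IsModel {r | r ∈ (ks.map Clause.rule).dedup} hc M := by
  intro r hr σ hσ
  obtain ⟨k, hk, rfl⟩ := List.mem_map.1 (List.mem_dedup.1 hr)
  obtain ⟨d, h1, h2⟩ := h k hk σ hσ
  refine ⟨Function.update σ 0 d, fun x hx => Function.update_of_ne ?_ _ _, ?_⟩
  · rintro rfl
    exact (hwf k hk).zero_notMem hx
  · rw [hhc]
    simp [Rule.head, Clause.rule, h1, h2]

/-- By safety, every head variable other than `0` occurs in the body, where `τ` and `σ` agree. -/
theorem holds_of_isModel {D : Type} {M : Set (Atom D)} {ks : List Clause} {hc : Rule → ℕ}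
    (hhc : ∀ r, hc r = 0) (h : IsModel {r | r ∈ (ks.map Clause.rule).dedup} hc M)
    (hwf : ∀ k ∈ ks, k.WF) : ∀ k ∈ ks, k.Holds M := by
  intro k hk σ hσ
  obtain ⟨τ, h1, h2⟩ := h k.rule (List.mem_dedup.2 (List.mem_map_of_mem hk)) σ hσ
  rw [hhc] at h2
  simp only [Rule.head, Clause.rule, List.getD_cons_zero, List.forall_mem_cons] at h2
  refine ⟨τ 0, ?_, h2.2.1⟩
  convert h2.1 using 1
  refine Atom.map_congr fun x hx => ?_
  by_cases h0 : x = 0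
  · simp [h0]
  · obtain ⟨a, ha, hxa⟩ := ((hwf k hk).safe x hx).resolve_left h0
    rw [Function.update_of_ne h0, h1 x (Rule.mem_vars.2 ⟨a, ha, hxa⟩)]

/-! ### Clauses that axiomatise lists and programs -/

/-- An injective numbering of codes. -/
def codeNum : Code → ℕ
  | .zero' => 0
  | .succ => 1
  | .tail => 2
  | .cons f g => 4 * Nat.pair (codeNum f) (codeNum g) + 3
  | .comp f g => 4 * Nat.pair (codeNum f) (codeNum g) + 4
  | .case f g => 4 * Nat.pair (codeNum f) (codeNum g) + 5
  | .fix f => 4 * codeNum f + 6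

/-- Compound codes are told apart by the residue modulo 4, the atomic ones by being smaller than
compound codes of the same residue; `Nat.pair` is injective. -/
theorem codeNum_injective : Function.Injective codeNum := by
  intro c
  induction c with
  | zero' | succ | tail => intro d h; cases d <;> simp only [codeNum] at h <;> first | rfl | omega
  | cons f g ihf ihg | comp f g ihf ihg | case f g ihf ihg =>
    intro d h
    cases d <;> simp only [codeNum] at h <;> try omega
    rename_i f' g'
    obtain ⟨h1, h2⟩ := Nat.pair_eq_pair.1
      (show Nat.pair (codeNum f) (codeNum g) = Nat.pair (codeNum f') (codeNum g') by omega)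
    rw [ihf h1, ihg h2]
  | fix f ih =>
    intro d h
    cases d <;> simp only [codeNum] at h <;> try omega
    rename_i f'
    rw [ih (show codeNum f = codeNum f' by omega)]

def graph {α : Type} (c : Code) (x y : α) : Atom α := bin (codeNum c + 5) x y

/-- The existential variable is essential: an old goal fact can make a trigger of this rule obsolete
without being its Skolem output. -/
def goalClause : Clause := ⟨[un 2 1], bin 4 1 0⟩

/-- The first three clauses create elements; increments are demanded only for results of prepending
or incrementing, that is, for non-empty lists. The next three define tails, and the last three copy
a head, with the empty list having default head zero. -/
def listClauses : List Clause := [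
  ⟨[un 1 1], bin 0 1 0⟩,
  ⟨[bin 0 1 2], bin 1 2 0⟩,
  ⟨[bin 1 1 2], bin 1 2 0⟩,
  ⟨[un 0 1], bin 2 1 1⟩,
  ⟨[bin 0 1 2], bin 2 2 1⟩,
  ⟨[bin 1 1 2, bin 2 1 3], bin 2 2 3⟩,
  ⟨[un 0 1, bin 0 2 3], ter 1 2 3⟩,
  ⟨[bin 0 4 1, bin 0 2 3], ter 1 2 3⟩,
  ⟨[bin 1 4 1, ter 4 2 3, bin 1 3 5], ter 1 2 5⟩]

/-- Tests on the head are done by reading `bin 0` and `bin 1` backwards: a list is empty, or a zero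
in front of a list, or an increment of a list. The empty list counts as having head zero in `case`
and `fix`. -/
def codeClauses : Code → List Clause
  | .zero' => [⟨[bin 0 1 2], graph .zero' 1 2⟩]
  | .succ => [⟨[un 0 1, ter 2 1 3, bin 1 3 4], graph .succ 2 4⟩]
  | .tail => [⟨[bin 2 1 2], graph .tail 1 2⟩]
  | .cons f g =>
    ⟨[graph f 1 2, graph g 1 3, ter 2 3 4], graph (.cons f g) 1 4⟩ ::
      (codeClauses f ++ codeClauses g)
  | .comp f g =>
    ⟨[graph g 1 2, graph f 2 3], graph (.comp f g) 1 3⟩ :: (codeClauses f ++ codeClauses g)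
  | .case f g =>
    ⟨[un 0 1, graph f 1 2], graph (.case f g) 1 2⟩ ::
    ⟨[bin 0 1 2, graph f 1 3], graph (.case f g) 2 3⟩ ::
    ⟨[bin 1 1 2, graph g 1 3], graph (.case f g) 2 3⟩ :: (codeClauses f ++ codeClauses g)
  | .fix f =>
    ⟨[graph f 1 2, un 0 2], graph (.fix f) 1 2⟩ ::
    ⟨[graph f 1 2, bin 0 3 2], graph (.fix f) 1 3⟩ ::
    ⟨[graph f 1 2, bin 1 3 2, bin 2 3 4, graph (.fix f) 4 5], graph (.fix f) 1 5⟩ ::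
      codeClauses f

def clauses (c : Code) : List Clause :=
  goalClause :: ⟨[bin 3 1 2, graph c 2 3], un 2 1⟩ :: (listClauses ++ codeClauses c)

theorem codeClauses_wf (c : Code) : ∀ k ∈ codeClauses c, k.WF ∧ k.head.pred ≠ (4, 1) := by
  induction c with
  | zero' | succ | tail =>
    simp only [codeClauses, List.forall_mem_cons]
    refine ⟨⟨⟨by simp, by simp, by simp [graph], by simp [graph]⟩, by simp [graph]⟩, by simp⟩
  | cons f g ihf ihg | comp f g ihf ihg =>
    simp only [codeClauses, List.forall_mem_cons, List.forall_mem_append]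
    exact ⟨⟨⟨by simp, by simp [graph], by simp [graph], by simp [graph]⟩, by simp [graph]⟩,
      ihf, ihg⟩
  | case f g ihf ihg =>
    simp only [codeClauses, List.forall_mem_cons, List.forall_mem_append]
    exact ⟨⟨⟨by simp, by simp [graph], by simp [graph], by simp [graph]⟩, by simp [graph]⟩,
      ⟨⟨by simp, by simp [graph], by simp [graph], by simp [graph]⟩, by simp [graph]⟩,
      ⟨⟨by simp, by simp [graph], by simp [graph], by simp [graph]⟩, by simp [graph]⟩, ihf, ihg⟩
  | fix f ihf =>
    simp only [codeClauses, List.forall_mem_cons]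
    exact ⟨⟨⟨by simp, by simp [graph], by simp [graph], by simp [graph]⟩, by simp [graph]⟩,
      ⟨⟨by simp, by simp [graph], by simp [graph], by simp [graph]⟩, by simp [graph]⟩,
      ⟨⟨by simp, by simp [graph], by simp [graph], by simp [graph]⟩, by simp [graph]⟩, ihf⟩

theorem listClauses_wf : ∀ k ∈ listClauses, k.WF ∧ k.head.pred ≠ (4, 1) := by
  simp only [listClauses, List.forall_mem_cons]
  refine ⟨?_, ?_, ?_, ?_, ?_, ?_, ?_, ?_, ?_, by simp⟩ <;>
    exact ⟨⟨by simp, by simp, by simp, by simp⟩, by simp⟩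

theorem clauses_wf (c : Code) : ∀ k ∈ clauses c, k.WF := by
  simp only [clauses, List.forall_mem_cons, List.forall_mem_append]
  refine ⟨⟨by simp [goalClause], by simp [goalClause], by simp [goalClause], by simp [goalClause]⟩,
    ⟨by simp, by simp [graph], by simp, by simp⟩, fun k hk => (listClauses_wf k hk).1,
    fun k hk => (codeClauses_wf c k hk).1⟩

theorem eq_goalClause {c : Code} {k : Clause} (hk : k ∈ clauses c) (h : k.head.pred = (4, 1)) :
    k = goalClause := by
  simp only [clauses, List.mem_cons, List.mem_append] at hk
  rcases hk with rfl | rfl | hk | hk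
  · rfl
  · simp at h
  · exact absurd h (listClauses_wf k hk).2
  · exact absurd h (codeClauses_wf c k hk).2

/-! ### Soundness: the standard interpretation -/

/-- The intended interpretation, with input `n`, in which nothing has halted. -/
def Standard (n : ℕ) : Set (Atom (List ℕ)) := {a | match a with
  | ⟨(0, 0), [v]⟩ => v = []
  | ⟨(1, 0), [_]⟩ => True
  | ⟨(0, 1), [v, w]⟩ => w = 0 :: v
  | ⟨(1, 1), [v, w]⟩ => v ≠ [] ∧ w = (v.headI + 1) :: v.tail
  | ⟨(2, 1), [v, w]⟩ => w = v.tail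
  | ⟨(3, 1), [_, w]⟩ => w = [n]
  | ⟨(4, 1), [_, _]⟩ => True
  | ⟨(k + 5, 1), [v, w]⟩ => ∃ c, codeNum c = k ∧ w ∈ c.eval v
  | ⟨(0, 2), [u, v, w]⟩ => w = u.headI :: v
  | _ => False}

section
variable (n : ℕ) (u v w : List ℕ)

@[simp] theorem standard_nil : un 0 v ∈ Standard n ↔ v = [] := Iff.rfl
@[simp] theorem standard_elem : un 1 v ∈ Standard n := trivial
@[simp] theorem standard_halted : un 2 v ∉ Standard n := id
@[simp] theorem standard_zero : bin 0 v w ∈ Standard n ↔ w = 0 :: v := Iff.rfl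
@[simp] theorem standard_succ :
    bin 1 v w ∈ Standard n ↔ v ≠ [] ∧ w = (v.headI + 1) :: v.tail := Iff.rfl
@[simp] theorem standard_tail : bin 2 v w ∈ Standard n ↔ w = v.tail := Iff.rfl
@[simp] theorem standard_input : bin 3 v w ∈ Standard n ↔ w = [n] := Iff.rfl
@[simp] theorem standard_goal : bin 4 v w ∈ Standard n := trivial
@[simp] theorem standard_cons : ter u v w ∈ Standard n ↔ w = u.headI :: v := Iff.rfl

@[simp] theorem standard_graph (c : Code) : graph c v w ∈ Standard n ↔ w ∈ c.eval v := by
  refine ⟨fun ⟨d, hd, h⟩ => codeNum_injective hd ▸ h, fun h => ⟨c, rfl, h⟩⟩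

@[simp] theorem map_graph {α β : Type} (f : α → β) (c : Code) (x y : α) :
    (graph c x y).map f = graph c (f x) (f y) := rfl

end

theorem mem_eval_cons {f g : Code} {v w : List ℕ} : w ∈ (Code.cons f g).eval v ↔
    ∃ a ∈ f.eval v, ∃ b ∈ g.eval v, w = a.headI :: b := by
  simp [Code.eval]

theorem mem_eval_comp {f g : Code} {v w : List ℕ} : w ∈ (Code.comp f g).eval v ↔
    ∃ a ∈ g.eval v, w ∈ f.eval a :=
  Part.mem_bind_iff

theorem mem_eval_fix {f : Code} {u v : List ℕ} : u ∈ (Code.fix f).eval v ↔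
    ∃ w ∈ f.eval v, w.headI = 0 ∧ u = w.tail ∨ w.headI ≠ 0 ∧ u ∈ (Code.fix f).eval w.tail := by
  refine PFun.mem_fix_iff.trans ?_
  constructor
  · rintro (h | ⟨x, h, hx⟩)
    · obtain ⟨w, hw, h⟩ := (Part.mem_map_iff _).1 h
      refine ⟨w, hw, Or.inl ?_⟩
      split_ifs at h with h0
      exact ⟨h0, (Sum.inl.inj h).symm⟩
    · obtain ⟨w, hw, h⟩ := (Part.mem_map_iff _).1 h
      refine ⟨w, hw, Or.inr ?_⟩
      split_ifs at h with h0
      exact ⟨h0, Sum.inr.inj h ▸ hx⟩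
  · rintro ⟨w, hw, ⟨h0, rfl⟩ | ⟨h0, h⟩⟩
    · exact Or.inl ((Part.mem_map_iff _).2 ⟨w, hw, if_pos h0⟩)
    · exact Or.inr ⟨w.tail, (Part.mem_map_iff _).2 ⟨w, hw, if_neg h0⟩, h⟩

/-- A halting loop makes finitely many iterations, all with the same final result `u`; hence only
the input varies in `C`. -/
theorem eval_fix_induction {f : Code} {u v : List ℕ} {C : List ℕ → Prop}
    (h : u ∈ (Code.fix f).eval v)
    (H : ∀ v, ∀ w ∈ f.eval v, w.headI = 0 ∧ u = w.tail ∨ w.headI ≠ 0 ∧ C w.tail → C v) : C v := by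
  refine PFun.fixInduction (C := C) h fun v hv ih => ?_
  obtain ⟨w, hw, h⟩ := mem_eval_fix.1 hv
  exact H v w hw (h.imp_right fun h' =>
    ⟨h'.1, ih _ ((Part.mem_map_iff _).2 ⟨w, hw, if_neg h'.1⟩)⟩)

theorem holds_codeClauses (n : ℕ) (c : Code) : ∀ k ∈ codeClauses c, k.Holds (Standard n) := by
  induction c with
  | zero' =>
    simp [codeClauses, Clause.Holds, Code.eval]
  | succ =>
    simp +contextual [codeClauses, Clause.Holds, Code.eval]
  | tail => simp [codeClauses, Clause.Holds, Code.eval]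
  | cons f g ihf ihg =>
    simp only [codeClauses, List.forall_mem_cons, List.forall_mem_append]
    refine ⟨?_, ihf, ihg⟩
    simp only [Clause.Holds, List.forall_mem_cons, map_graph, map_ter, standard_graph,
      standard_cons]
    rintro σ ⟨h1, h2, h3, -⟩
    -- The variable `0` does not occur in this head, so any list can serve as its value.
    refine ⟨[], ?_, standard_elem _ _⟩
    exact mem_eval_cons.2 ⟨_, h1, _, h2, h3⟩
  | comp f g ihf ihg =>
    simp only [codeClauses, List.forall_mem_cons, List.forall_mem_append]
    refine ⟨?_, ihf, ihg⟩
    simp only [Clause.Holds, List.forall_mem_cons, map_graph, standard_graph]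
    rintro σ ⟨h1, h2, -⟩
    refine ⟨[], ?_, standard_elem _ _⟩
    exact mem_eval_comp.2 ⟨_, h1, h2⟩
  | case f g ihf ihg =>
    simp only [codeClauses, List.forall_mem_cons, List.forall_mem_append]
    refine ⟨?_, ?_, ?_, ihf, ihg⟩
    · simp only [Clause.Holds, List.forall_mem_cons, map_un, map_graph, standard_graph,
        standard_nil]
      rintro σ ⟨h1, h2, -⟩
      exact ⟨[], by simpa [Code.eval, h1] using h2, standard_elem _ _⟩
    · simp only [Clause.Holds, List.forall_mem_cons, map_bin, map_graph, standard_graph,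
        standard_zero]
      rintro σ ⟨h1, h2, -⟩
      exact ⟨[], by simpa [Code.eval, h1] using h2, standard_elem _ _⟩
    · simp only [Clause.Holds, List.forall_mem_cons, map_bin, map_graph, standard_graph,
        standard_succ]
      rintro σ ⟨⟨h0, h1⟩, h2, -⟩
      obtain ⟨a, l, hal⟩ := List.exists_cons_of_ne_nil h0
      rw [hal] at h1 h2
      exact ⟨[], by simpa [Code.eval, h1] using h2, standard_elem _ _⟩
  | fix f ihf =>
    simp only [codeClauses, List.forall_mem_cons]
    refine ⟨?_, ?_, ?_, ihf⟩
    · simp only [Clause.Holds, List.forall_mem_cons, map_un, map_graph, standard_graph,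
        standard_nil]
      rintro σ ⟨h1, h2, -⟩
      exact ⟨[], mem_eval_fix.2 ⟨_, h1, by simp [h2]⟩, standard_elem _ _⟩
    · simp only [Clause.Holds, List.forall_mem_cons, map_bin, map_graph, standard_graph,
        standard_zero]
      rintro σ ⟨h1, h2, -⟩
      exact ⟨[], mem_eval_fix.2 ⟨_, h1, by simp [h2]⟩, standard_elem _ _⟩
    · simp only [Clause.Holds, List.forall_mem_cons, map_bin, map_graph, standard_graph,
        standard_succ, standard_tail]
      rintro σ ⟨h1, ⟨-, h2⟩, h3, h4, -⟩
      refine ⟨[], mem_eval_fix.2 ⟨_, h1, Or.inr ⟨by simp [h2], ?_⟩⟩, standard_elem _ _⟩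
      rw [h2, List.tail_cons, ← h3]
      exact h4

theorem holds_listClauses (n : ℕ) : ∀ k ∈ listClauses, k.Holds (Standard n) := by
  simp only [listClauses, List.forall_mem_cons]
  refine ⟨?_, ?_, ?_, ?_, ?_, ?_, ?_, ?_, ?_, by simp⟩ <;> simp +contextual [Clause.Holds]

theorem standard_isModel {n : ℕ} {c : Code} (h : ¬ (c.eval [n]).Dom) {hc : Rule → ℕ}
    (hhc : ∀ r, hc r = 0) :
    IsModel {r | r ∈ ((clauses c).map Clause.rule).dedup} hc (Standard n) := by
  refine isModel_of_holds hhc (clauses_wf c) ?_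
  simp only [clauses, List.forall_mem_cons, List.forall_mem_append]
  refine ⟨?_, ?_, holds_listClauses n, holds_codeClauses n c⟩
  · simp [Clause.Holds, goalClause]
  -- The body of the halting clause would provide an output of `c` on `[n]`.
  · intro σ hσ
    simp at hσ
    rw [hσ.1] at hσ
    exact absurd (Part.dom_iff_mem.2 ⟨_, hσ.2⟩) h

end Theory

/-! ### Completeness: every model contains the computation -/

section Completeness

variable {D : Type} {M : Set (Atom D)}

/-- The element `t` represents the list in `M`. -/
inductive Rep (M : Set (Atom D)) : List ℕ → D → Prop
  | nil {t} (ht : un 1 t ∈ M) (h : un 0 t ∈ M) : Rep M [] t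
  | zero {v x t} (ht : un 1 t ∈ M) (h : bin 0 x t ∈ M) (hx : Rep M v x) : Rep M (0 :: v) t
  | succ {a v x t} (ht : un 1 t ∈ M) (h : bin 1 x t ∈ M) (hx : Rep M (a :: v) x) :
    Rep M ((a + 1) :: v) t

theorem Rep.elem {v : List ℕ} {t : D} (h : Rep M v t) : un 1 t ∈ M := by
  cases h <;> assumption

theorem Clause.Holds.apply {k : Clause} (h : k.Holds M) (hk : 0 ∉ k.head.args) (σ : Var → D)
    (hσ : ∀ a ∈ k.body, a.map σ ∈ M) : k.head.map σ ∈ M := by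
  obtain ⟨d, hd, -⟩ := h σ hσ
  convert hd using 1
  exact Atom.map_congr fun x hx => (Function.update_of_ne (ne_of_mem_of_not_mem hx hk) _ _).symm

/-- The assignment of elements to the variables `1, …, 5`. -/
def assign (x₁ x₂ x₃ x₄ x₅ : D) : Var → D
  | 1 => x₁
  | 2 => x₂
  | 3 => x₃
  | 4 => x₄
  | _ => x₅

section ListClauses

variable (hM : ∀ k ∈ listClauses, k.Holds M)
include hM

theorem Rep.exists_zero {v : List ℕ} {t : D} (h : Rep M v t) :
    ∃ s, bin 0 t s ∈ M ∧ Rep M (0 :: v) s := by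
  obtain ⟨s, h1, h2⟩ := hM ⟨[un 1 1], bin 0 1 0⟩ (by simp [listClauses]) (assign t t t t t)
    (by simpa [assign] using h.elem)
  have h1 : bin 0 t s ∈ M := by simpa [assign] using h1
  exact ⟨s, h1, .zero h2 h1 h⟩

/-- A representation of a non-empty list ends with a prepended zero or an increment, and each of the
two has its own clause that creates the increment. -/
theorem Rep.exists_succ {a : ℕ} {v : List ℕ} {t : D} (h : Rep M (a :: v) t) :
    ∃ s, bin 1 t s ∈ M ∧ Rep M ((a + 1) :: v) s := by
  suffices ∃ s, bin 1 t s ∈ M ∧ un 1 s ∈ M from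
    let ⟨s, h1, h2⟩ := this
    ⟨s, h1, .succ h2 h1 h⟩
  cases h with
  | @zero _ x _ ht hx _ =>
    obtain ⟨s, h1, h2⟩ := hM ⟨[bin 0 1 2], bin 1 2 0⟩ (by simp [listClauses]) (assign x t t t t)
      (by simpa [assign] using hx)
    exact ⟨s, by simpa [assign] using h1, h2⟩
  | @succ _ _ x _ ht hx _ =>
    obtain ⟨s, h1, h2⟩ := hM ⟨[bin 1 1 2], bin 1 2 0⟩ (by simp [listClauses]) (assign x t t t t)
      (by simpa [assign] using hx)
    exact ⟨s, by simpa [assign] using h1, h2⟩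

theorem Rep.exists_tail {v : List ℕ} {t : D} (h : Rep M v t) :
    ∃ s, bin 2 t s ∈ M ∧ Rep M v.tail s := by
  induction h with
  | @nil t ht h =>
    have := (hM ⟨[un 0 1], bin 2 1 1⟩ (by simp [listClauses])).apply (by simp)
      (assign t t t t t) (by simpa [assign] using h)
    exact ⟨t, by simpa [assign] using this, .nil ht h⟩
  | @zero v x t ht h hx ih =>
    have := (hM ⟨[bin 0 1 2], bin 2 2 1⟩ (by simp [listClauses])).apply (by simp)
      (assign x t t t t) (by simpa [assign] using h)
    exact ⟨x, by simpa [assign] using this, hx⟩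
  | @succ a v x t ht h hx ih =>
    obtain ⟨s, hs, hrep⟩ := ih
    have := (hM ⟨[bin 1 1 2, bin 2 1 3], bin 2 2 3⟩ (by simp [listClauses])).apply (by simp)
      (assign x t s t t) (by simpa [assign] using ⟨h, hs⟩)
    exact ⟨s, by simpa [assign] using this, hrep⟩

/-- The head of `u` is copied by prepending a zero to `v` and replaying the increments recorded in
the representation of `u`. -/
theorem Rep.exists_cons {u v : List ℕ} {t s : D} (ht : Rep M u t) (hs : Rep M v s) :
    ∃ y, ter t s y ∈ M ∧ Rep M (u.headI :: v) y := by
  induction ht with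
  | @nil t ht h =>
    obtain ⟨y, hy, hrep⟩ := hs.exists_zero hM
    have := (hM ⟨[un 0 1, bin 0 2 3], ter 1 2 3⟩ (by simp [listClauses])).apply (by simp)
      (assign t s y t t) (by simpa [assign] using ⟨h, hy⟩)
    exact ⟨y, by simpa [assign] using this, hrep⟩
  | @zero _ x t ht h hx ih =>
    obtain ⟨y, hy, hrep⟩ := hs.exists_zero hM
    have := (hM ⟨[bin 0 4 1, bin 0 2 3], ter 1 2 3⟩ (by simp [listClauses])).apply (by simp)
      (assign t s y x t) (by simpa [assign] using ⟨h, hy⟩)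
    exact ⟨y, by simpa [assign] using this, hrep⟩
  | @succ a _ x t ht h hx ih =>
    obtain ⟨y, hy, hrep⟩ := ih
    obtain ⟨z, hz, hrep'⟩ := hrep.exists_succ hM
    have := (hM ⟨[bin 1 4 1, ter 4 2 3, bin 1 3 5], ter 1 2 5⟩ (by simp [listClauses])).apply
      (by simp) (assign t s y x z) (by simpa [assign] using ⟨h, hy, hz⟩)
    exact ⟨z, by simpa [assign] using this, hrep'⟩

theorem Rep.exists_graph (hnil : ∃ t, Rep M [] t) (c : Code)
    (hc : ∀ k ∈ codeClauses c, k.Holds M) {v w : List ℕ} {t : D} (ht : Rep M v t)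
    (hw : w ∈ c.eval v) : ∃ s, graph c t s ∈ M ∧ Rep M w s := by
  induction c generalizing v w t with
  | zero' =>
    obtain ⟨s, hs, hrep⟩ := ht.exists_zero hM
    simp only [codeClauses, List.forall_mem_cons] at hc
    have := hc.1.apply (by simp [graph]) (assign t s t t t) (by simpa [assign] using hs)
    obtain rfl : w = 0 :: v := by simpa [Code.eval] using hw
    exact ⟨s, by simpa [assign] using this, hrep⟩
  | succ =>
    -- `Code.succ` drops the tail, so its result is built on a representation of the empty list.
    obtain ⟨e, he⟩ := hnil
    obtain ⟨y, hy, hrep⟩ := ht.exists_cons hM he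
    obtain ⟨s, hs, hrep⟩ := hrep.exists_succ hM
    simp only [codeClauses, List.forall_mem_cons] at hc
    have he' : un 0 e ∈ M := by cases he; assumption
    have := hc.1.apply (by simp [graph]) (assign e t y s t)
      (by simpa [assign] using ⟨he', hy, hs⟩)
    obtain rfl : w = [v.headI + 1] := by simpa [Code.eval] using hw
    exact ⟨s, by simpa [assign] using this, hrep⟩
  | tail =>
    obtain ⟨s, hs, hrep⟩ := ht.exists_tail hM
    simp only [codeClauses, List.forall_mem_cons] at hc
    have := hc.1.apply (by simp [graph]) (assign t s t t t) (by simpa [assign] using hs)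
    obtain rfl : w = v.tail := by simpa [Code.eval] using hw
    exact ⟨s, by simpa [assign] using this, hrep⟩
  | cons f g ihf ihg =>
    simp only [codeClauses, List.forall_mem_cons, List.forall_mem_append] at hc
    obtain ⟨a, ha, b, hb, rfl⟩ := mem_eval_cons.1 hw
    obtain ⟨x, hx, hxrep⟩ := ihf hc.2.1 ht ha
    obtain ⟨y, hy, hyrep⟩ := ihg hc.2.2 ht hb
    obtain ⟨s, hs, hrep⟩ := hxrep.exists_cons hM hyrep
    have := hc.1.apply (by simp [graph]) (assign t x y s t) (by simpa [assign] using ⟨hx, hy, hs⟩)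
    exact ⟨s, by simpa [assign] using this, hrep⟩
  | comp f g ihf ihg =>
    simp only [codeClauses, List.forall_mem_cons, List.forall_mem_append] at hc
    obtain ⟨a, ha, hb⟩ := mem_eval_comp.1 hw
    obtain ⟨x, hx, hxrep⟩ := ihg hc.2.2 ht ha
    obtain ⟨s, hs, hrep⟩ := ihf hc.2.1 hxrep hb
    have := hc.1.apply (by simp [graph]) (assign t x s t t) (by simpa [assign] using ⟨hx, hs⟩)
    exact ⟨s, by simpa [assign] using this, hrep⟩
  | case f g ihf ihg =>
    simp only [codeClauses, List.forall_mem_cons, List.forall_mem_append] at hc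
    obtain ⟨h1, h2, h3, hf, hg⟩ := hc
    cases ht with
    | nil ht h =>
      obtain ⟨s, hs, hrep⟩ := ihf hf (.nil ht h) (by simpa [Code.eval] using hw)
      have := h1.apply (by simp [graph]) (assign t s t t t) (by simpa [assign] using ⟨h, hs⟩)
      exact ⟨s, by simpa [assign] using this, hrep⟩
    | @zero v x _ ht h hx =>
      obtain ⟨s, hs, hrep⟩ := ihf hf hx (by simpa [Code.eval] using hw)
      have := h2.apply (by simp [graph]) (assign x t s t t) (by simpa [assign] using ⟨h, hs⟩)
      exact ⟨s, by simpa [assign] using this, hrep⟩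
    | @succ a v x _ ht h hx =>
      obtain ⟨s, hs, hrep⟩ := ihg hg hx (by simpa [Code.eval] using hw)
      have := h3.apply (by simp [graph]) (assign x t s t t) (by simpa [assign] using ⟨h, hs⟩)
      exact ⟨s, by simpa [assign] using this, hrep⟩
  | fix f ihf =>
    simp only [codeClauses, List.forall_mem_cons] at hc
    obtain ⟨h1, h2, h3, hf⟩ := hc
    -- The motive quantifies over `t`, since each iteration continues from another element.
    refine eval_fix_induction (C := fun v => ∀ t, Rep M v t →
      ∃ s, graph (.fix f) t s ∈ M ∧ Rep M w s) hw
      (fun v a ha hcase t ht => ?_) t ht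
    obtain ⟨x, hx, hxrep⟩ := ihf hf ht ha
    cases hxrep with
    | nil hx' h =>
      obtain rfl : w = [] := by simpa using hcase
      have := h1.apply (by simp [graph]) (assign t x t t t) (by simpa [assign] using ⟨hx, h⟩)
      exact ⟨x, by simpa [assign] using this, .nil hx' h⟩
    | @zero b y _ hx' h hy =>
      obtain rfl : w = b := by simpa using hcase
      have := h2.apply (by simp [graph]) (assign t x y t t) (by simpa [assign] using ⟨hx, h⟩)
      exact ⟨y, by simpa [assign] using this, hy⟩
    | @succ a b y _ hx' h hy =>
      obtain ⟨z, hz, hzrep⟩ := hy.exists_tail hM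
      obtain ⟨s, hs, hrep⟩ := (hcase.resolve_left (by simp)).2 z hzrep
      have := h3.apply (by simp [graph]) (assign t x y z s)
        (by simpa [assign] using ⟨hx, h, hz, hs⟩)
      exact ⟨s, by simpa [assign] using this, hrep⟩

end ListClauses
end Completeness

/-! ### The reduction and its correctness -/

section Reduction

/-- The database that encodes the input `n` by a chain of constants. -/
@[irreducible] def haltDB (n : ℕ) : List Fact :=
  -- The constant `0` represents the empty list and `i + 1` the list `[i]`. The constant `0` also
  -- carries the input and halting marks, and its goal fact makes the goal trigger obsolete.
  [un 0 (.const 0), bin 0 (.const 0) (.const 1), bin 3 (.const 0) (.const (n + 1)),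
    bin 4 (.const 0) (.const 0)] ++
  ((List.range (n + 2)).map (fun i => un 1 (.const i)) ++
    (List.range n).map (fun i => bin 1 (.const (i + 1)) (.const (i + 2))))

theorem forall_mem_haltDB {n : ℕ} {P : Fact → Prop} (h0 : P (un 0 (.const 0)))
    (h1 : P (bin 0 (.const 0) (.const 1))) (h3 : P (bin 3 (.const 0) (.const (n + 1))))
    (h4 : P (bin 4 (.const 0) (.const 0))) (he : ∀ i, P (un 1 (.const i)))
    (hs : ∀ i, P (bin 1 (.const (i + 1)) (.const (i + 2)))) : ∀ A ∈ haltDB n, P A := by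
  intro A hA
  simp only [haltDB, List.mem_append, List.mem_map, List.mem_cons, List.not_mem_nil, or_false] at hA
  rcases hA with (rfl | rfl | rfl | rfl) | ⟨i, -, rfl⟩ | ⟨i, -, rfl⟩
  exacts [h0, h1, h3, h4, he i, hs i]

@[irreducible] def haltRules (c : Code) : List Rule := ((clauses c).map Clause.rule).dedup

def goalTrigger : Trigger := ⟨goalClause.rule, [(1, .const 0)]⟩

/-- An instance of the decision problem that is negative iff `c` halts on `n`. -/
def haltInput (c : Code) (n : ℕ) : Input where
  rules := haltRules c
  db := haltDB n
  choice := (haltRules c).map fun r => (r, 0)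
  trigger := goalTrigger

variable (c : Code) (n : ℕ)

theorem haltInput_hc (r : Rule) : (haltInput c n).hc r = 0 := by
  rw [Input.hc]
  simp only [haltInput]
  induction haltRules c with
  | nil => rfl
  | cons s l ih =>
    rw [List.map_cons, List.lookup]
    split
    · rfl
    · exact ih

theorem mem_haltRules {r : Rule} : r ∈ haltRules c ↔ ∃ k ∈ clauses c, k.rule = r := by
  rw [haltRules, List.mem_dedup, List.mem_map]

theorem haltInput_rules :
    (haltInput c n).kb.rules = {r | r ∈ ((clauses c).map Clause.rule).dedup} := by
  ext r
  rw [Set.mem_ofPred, List.mem_dedup, List.mem_map]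
  exact mem_haltRules c

theorem haltInput_db : (haltInput c n).kb.db = {A | A ∈ haltDB n} := rfl

theorem exists_clause {r : Rule} (hr : r ∈ (haltInput c n).kb.rules) :
    ∃ k ∈ clauses c, k.rule = r :=
  (mem_haltRules c).1 hr

theorem haltInput_deterministic : ∀ r ∈ (haltInput c n).kb.rules, r.Deterministic := by
  intro r hr
  obtain ⟨k, -, rfl⟩ := exists_clause c n hr
  rfl

theorem haltInput_generating : ∀ r ∈ (haltInput c n).kb.rules, r.Generating := by
  intro r hr
  obtain ⟨k, hk, rfl⟩ := exists_clause c n hr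
  exact (clauses_wf c k hk).generating

theorem haltInput_kb_wf : (haltInput c n).kb.WF where
  rule_wf r hr := by
    obtain ⟨k, hk, rfl⟩ := exists_clause c n hr
    exact (clauses_wf c k hk).rule
  fact_wf := forall_mem_haltDB (by simp) (by simp) (by simp) (by simp) (by simp) (by simp)
  function_free := forall_mem_haltDB (by simp) (by simp) (by simp) (by simp) (by simp) (by simp)

theorem goalClause_mem : goalClause ∈ clauses c := List.mem_cons_self

theorem haltInput_valid : (haltInput c n).Valid where
  kb_wf := haltInput_kb_wf c n
  choice_nodup := by
    simpa [haltInput, haltRules, Function.comp_def] using List.nodup_dedup _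
  choice_dom r := by simp [haltInput]
  choice_range r hr := by
    rw [haltInput_hc, haltInput_deterministic c n r hr]
    exact one_pos
  trigger_wf := by
    refine ⟨(mem_haltRules c).2 ⟨_, goalClause_mem c, rfl⟩, by simp [haltInput, goalTrigger],
      fun x => ?_, ?_⟩
    · simp [haltInput, goalTrigger, goalClause, Clause.rule, Rule.bodyVars, Rule.vars]
    · simp [haltInput, goalTrigger, IsRTerm.const]

theorem goalTrigger_loaded {F : Set Fact} : goalTrigger.Loaded F ↔ un 2 (.const 0) ∈ F := by
  simp [goalTrigger, Trigger.Loaded, goalClause, Clause.rule, Trigger.val]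

/-- Holds vacuously: loading the trigger would yield a halted element in the standard model. -/
theorem gUnblockable_of_not_dom (h : ¬ (c.eval [n]).Dom) :
    GUnblockable (haltInput c n).kb (haltInput c n).hc goalTrigger := by
  intro T b hb m v hv hload
  have key := hb.interp (haltInput_rules c n ▸ standard_isModel h (haltInput_hc c n))
    (c₀ := fun i => if i = 0 then [] else [i - 1])
    (forall_mem_haltDB (by simp [GTerm.interp]) (by simp [GTerm.interp]) (by simp [GTerm.interp])
      (by simp) (by simp) (by simp [GTerm.interp])) m v hv _ (goalTrigger_loaded.1 hload)
  simp at key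

theorem rep_const {M : Set Fact} (hdb : ∀ A ∈ haltDB n, A ∈ M) :
    ∀ i ≤ n, Rep M [i] (.const (i + 1)) := by
  have helem : ∀ i < n + 2, un 1 (.const i) ∈ M := fun i hi =>
    hdb _ (by simp only [haltDB, List.mem_append, List.mem_map, List.mem_range]
              exact Or.inr (Or.inl ⟨i, hi, rfl⟩))
  intro i
  induction i with
  | zero =>
    intro _
    exact .zero (helem 1 (by omega)) (hdb _ (by simp [haltDB]))
      (.nil (helem 0 (by omega)) (hdb _ (by simp [haltDB])))
  | succ i ih =>
    intro hi
    refine .succ (helem (i + 2) (by omega)) (hdb _ ?_) (ih (by omega))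
    simp only [haltDB, List.mem_append, List.mem_map, List.mem_range]
    exact Or.inr (Or.inr ⟨i, by omega, rfl⟩)

/-- The union of all stages is itself a model of the clauses, so completeness applies with ground
terms as elements. -/
theorem halted_mem_chaseSeq (h : (c.eval [n]).Dom) :
    ∃ m, un 2 (.const 0) ∈ chaseSeq (haltInput c n).kb m := by
  rw [← Set.mem_iUnion]
  have hM := holds_of_isModel (fun _ => rfl) (haltInput_rules c n ▸
    chaseSeq_isModel (haltInput_kb_wf c n) (haltInput_deterministic c n)) (clauses_wf c)
  set M := ⋃ m, chaseSeq (haltInput c n).kb m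
  have hdb : ∀ A ∈ haltDB n, A ∈ M := fun A hA => Set.mem_iUnion.2 ⟨0, hA⟩
  simp only [clauses, List.forall_mem_cons, List.forall_mem_append] at hM
  obtain ⟨-, hq, hlist, hcode⟩ := hM
  obtain ⟨w, hw⟩ := Part.dom_iff_mem.1 h
  have hnil : Rep M [] (.const 0) :=
    .nil (hdb _ (by simp only [haltDB, List.mem_append, List.mem_map, List.mem_range]
                    exact Or.inr (Or.inl ⟨0, by omega, rfl⟩))) (hdb _ (by simp [haltDB]))
  obtain ⟨s, hs, -⟩ := Rep.exists_graph hlist ⟨_, hnil⟩ c hcode (rep_const n hdb n le_rfl) hw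
  have := hq.apply (by simp) (assign (.const 0) (.const (n + 1)) s s s)
    (by simpa [assign] using ⟨hdb _ (by simp [haltDB]), hs⟩)
  simpa [assign] using this

/-- The trigger is obsolete from the start, and no other trigger has an output `Goal(0, t)`. -/
theorem chaseSeq_goal (m : ℕ) :
    (bin 4 (GTerm.const 0) (.const 0) ∈ chaseSeq (haltInput c n).kb m ∧
      un 1 (GTerm.const 0) ∈ chaseSeq (haltInput c n).kb m) ∧
      ∀ t, bin 4 (GTerm.const 0) t ∈ chaseSeq (haltInput c n).kb m → t = .const 0 := by
  refine chaseSeq_induction (P := fun F => (bin 4 (GTerm.const 0) (.const 0) ∈ F ∧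
    un 1 (GTerm.const 0) ∈ F) ∧ ∀ t, bin 4 (GTerm.const 0) t ∈ F → t = .const 0)
    ⟨⟨?_, ?_⟩, ?_⟩ (fun F l hF hl => ⟨⟨Or.inl hF.1.1, Or.inl hF.1.2⟩, ?_⟩) m
  · rw [haltInput_db]
    simp [haltDB]
  · rw [haltInput_db]
    simp only [haltDB, Set.mem_ofPred, List.mem_append, List.mem_map, List.mem_range]
    exact Or.inr (Or.inl ⟨0, by omega, rfl⟩)
  · intro t ht
    have := forall_mem_haltDB (n := n)
      (P := fun A => A = bin 4 (.const 0) t → t = .const 0) (by simp [un, bin]) (by simp [bin])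
      (by simp [bin]) (by simp +contextual [bin]) (by simp [un, bin]) (by simp [bin])
    exact this _ ht rfl
  · rintro t (ht | ⟨a, ha, hat⟩)
    · exact hF.2 t ht
    · exfalso
      obtain ⟨k, hk, hkr⟩ := exists_clause c n hl.1.rule_mem
      rw [← hkr] at ha
      simp only [Rule.head, Clause.rule, List.getD_cons_zero, List.mem_cons, List.not_mem_nil,
        or_false] at ha
      have hpred : a.pred = (4, 1) := (congrArg Atom.pred hat).symm
      rcases ha with rfl | rfl
      -- Only the goal rule produces goal facts. The first argument forces `l` to send the variable
      -- `1` to the constant `0`, and then the goal fact from the database makes `l` obsolete, so it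
      -- was not applicable.
      · obtain rfl := eq_goalClause hk hpred
        have hval : l.val 1 = .const 0 := by
          have h1 : GTerm.const 0 = l.skolemVal 0 1 := (List.cons.inj (congrArg Atom.args hat)).1
          rw [h1, Trigger.skolemVal, if_pos]
          rw [← hkr]
          simp [goalClause, Clause.rule, Rule.bodyVars, Rule.vars]
        refine hl.2.2 ⟨fun _ => .const 0, ?_, 0, ?_, ?_⟩
        · rw [← hkr]
          simp [goalClause, Clause.rule, Rule.bodyVars, Rule.vars, hval]
        · rw [← hkr]
          exact one_pos
        · rw [← hkr]
          simpa [goalClause, Clause.rule, Rule.head] using hF.1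
      · simp at hpred

theorem gUnblockable_haltInput_iff :
    GUnblockable (haltInput c n).kb (haltInput c n).hc (haltInput c n).trigger ↔
      ¬ (c.eval [n]).Dom := by
  refine ⟨fun hu h => ?_, gUnblockable_of_not_dom c n⟩
  obtain ⟨m, hm⟩ := halted_mem_chaseSeq c n h
  refine not_gUnblockable_of_chaseSeq (haltInput_kb_wf c n) (haltInput_deterministic c n)
    (haltInput_generating c n) (haltInput_hc c n) ⟨m, goalTrigger_loaded.2 hm⟩ (fun k hk => ?_) hu
  -- If the output appeared, its Skolem term would equal the constant `0`.
  have hgoal := (chaseSeq_goal c n k).2 (goalTrigger.skolemVal 0 0) (hk ?_)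
  · simp [Trigger.skolemVal, goalTrigger, goalClause, Clause.rule, Rule.bodyVars, Rule.vars]
      at hgoal
  · refine ⟨bin 4 1 0, by simp [Rule.head, goalTrigger, goalClause, Clause.rule], ?_⟩
    simp [Trigger.skolemVal, goalTrigger, goalClause, Clause.rule, Rule.bodyVars, Rule.vars,
      Trigger.val]

/-! ### Computability of the reduction -/

theorem primrec_const : Primrec GTerm.const := by
  refine Primrec.encode_iff.1 (Primrec.nat_double.of_eq fun c => ?_)
  change _ = (GTerm.const c).toNat
  rw [GTerm.toNat]

theorem primrec_atom {α : Type} [Primcodable α] {f : α → Pred × List GTerm} (hf : Primrec f) :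
    Primrec fun x => (⟨(f x).1, (f x).2⟩ : Fact) :=
  Primrec.encode_iff.1 (show Primrec fun x => Encodable.encode (f x) from Primrec.encode.comp hf)

theorem primrec_un {α : Type} [Primcodable α] (p : ℕ) {f : α → GTerm} (hf : Primrec f) :
    Primrec fun x => un p (f x) :=
  primrec_atom (f := fun x => ((p, 0), [f x]))
    ((Primrec.const _).pair (Primrec.list_cons.comp hf (Primrec.const _)))

theorem primrec_bin {α : Type} [Primcodable α] (p : ℕ) {f g : α → GTerm} (hf : Primrec f)
    (hg : Primrec g) : Primrec fun x => bin p (f x) (g x) :=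
  primrec_atom (f := fun x => ((p, 1), [f x, g x]))
    ((Primrec.const _).pair (Primrec.list_cons.comp hf (Primrec.list_cons.comp hg
      (Primrec.const _))))

theorem primrec_haltDB : Primrec haltDB := by
  have hconst : ∀ k, Primrec fun n : ℕ => GTerm.const (n + k) := fun k =>
    primrec_const.comp (Primrec.nat_add.comp Primrec.id (Primrec.const k))
  have h0 : Primrec fun _ : ℕ => GTerm.const 0 := Primrec.const _
  have h1 : Primrec fun _ : ℕ => GTerm.const 1 := Primrec.const _
  have he : Primrec fun n : ℕ => (List.range (n + 2)).map fun i => un 1 (GTerm.const i) :=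
    Primrec.list_map (Primrec.list_range.comp (Primrec.nat_add.comp Primrec.id (Primrec.const 2)))
      ((primrec_un 1 (hconst 0)).comp Primrec.snd).to₂
  have hs : Primrec fun n : ℕ =>
      (List.range n).map fun i => bin 1 (GTerm.const (i + 1)) (.const (i + 2)) :=
    Primrec.list_map Primrec.list_range
      ((primrec_bin 1 (hconst 1) (hconst 2)).comp Primrec.snd).to₂
  refine (Primrec.list_append.comp
    (Primrec.list_cons.comp (primrec_un 0 h0) <| Primrec.list_cons.comp (primrec_bin 0 h0 h1) <|
      Primrec.list_cons.comp (primrec_bin 3 h0 (hconst 1)) <|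
      Primrec.list_cons.comp (primrec_bin 4 h0 h0) (Primrec.const []))
    (Primrec.list_append.comp he hs)).of_eq fun n => ?_
  rw [haltDB]

/-- With `c` fixed, only the database depends on `n`; the construction of the rules need not be
shown computable. -/
theorem computable_haltInput : Computable (haltInput c) := by
  have h : Primrec fun n => (haltRules c, haltDB n, (haltRules c).map fun r => (r, 0),
      goalTrigger) :=
    (Primrec.const _).pair (primrec_haltDB.pair (Primrec.const _))
  exact (Primrec.encode_iff.1 (Primrec.encode.comp h)).to_comp

/-- A universal program serves: on `n` it runs the `n`-th partial recursive code on input `0`. -/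
theorem exists_code_not_computable :
    ∃ c : Code, ¬ ComputablePred fun n : ℕ => (c.eval [n]).Dom := by
  let g : ℕ →. ℕ := fun n => (Denumerable.ofNat Nat.Partrec.Code n).eval 0
  have hg : Partrec g :=
    Nat.Partrec.Code.eval_part.comp (Computable.ofNat _) (Computable.const 0)
  obtain ⟨c, hc⟩ := Code.exists_code (Nat.Partrec'.part_iff₁.2 hg)
  refine ⟨c, fun h => ComputablePred.halting_problem 0 ?_⟩
  have hdom : ∀ n, (c.eval [n]).Dom ↔ (g n).Dom := fun n => by
    rw [show c.eval [n] = _ from hc ⟨[n], rfl⟩]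
    rfl
  obtain ⟨f, hf, hp⟩ := ComputablePred.computable_iff.1 h
  refine ComputablePred.computable_iff.2
    ⟨fun d => f (Encodable.encode d), hf.comp Computable.encode, funext fun d => ?_⟩
  rw [← congrFun hp (Encodable.encode d), hdom]
  simp [g]

end Reduction
end DisjChase

theorem mainTheorem8 :
    ¬ ∃ f : DisjChase.Input →. Bool, Partrec f ∧
      ∀ I : DisjChase.Input, I.Valid →
        ∃ b ∈ f I, (b = true ↔ DisjChase.GUnblockable I.kb I.hc I.trigger) := by
  rintro ⟨f, hf, h⟩
  obtain ⟨c, hc⟩ := DisjChase.exists_code_not_computable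
  choose g hg hgu using fun n => h _ (DisjChase.haltInput_valid c n)
  refine hc (ComputablePred.computable_iff.2 ⟨fun n => !g n, ?_, funext fun n => ?_⟩)
  -- The algorithm `f` may be partial, but it answers on all valid inputs, so its composition with
  -- the reduction is total.
  · have hgc : Computable g := (hf.comp (DisjChase.computable_haltInput c)).of_eq fun n =>
      Part.eq_some_iff.2 (hg n)
    exact Primrec.not.to_comp.comp hgc
  · have := (hgu n).trans (DisjChase.gUnblockable_haltInput_iff c n)
    cases hgn : g n <;> simp_all
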